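/- Let $1\le d\le n$ and $1\le k\le n$ be integers, let $\bm a_1,\dots,\bm a_n\in\mathbb R^d$, and let $\lambda>0$. Let $$z_k:=\min_{S\subseteq[n],\,|S|=k}\operatorname{tr}\Big(\Big(\sum_{i\in S}\bm a_i\bm a_i^\top+\lambda \bm I_d\Big)^{-1}\Big)$$ be the optimal value of the regularized A-optimal design problem. Put $\tilde k:=\min\{k,d\}$, and for a symmetric positive semidefinite $d\times d$ matrix $\bm X$ with eigenvalues $\sigma_1\ge\dots\ge\sigma_d\ge 0$ let $\Gamma(\bm X;\lambda):=\sum_{i=1}^{\tilde k}\frac{1}{\sigma_i+\lambda}$. Let $\operatorname{conv}\Gamma(\,\cdot\,;\lambda)$ be the convex envelope of $\Gamma(\,\cdot\,;\lambda)$ on the cone $\mathcal S^d_+$ of symmetric positive semidefinite $d\times d$ matrices, i.e. the largest convex function on $\mathcal S^d_+$ that is nowhere larger than $\Gamma(\,\cdot\,;\lambda)$. Let $$\nu^{\mathrm N}_k:=\inf\Big\{\operatorname{conv}\Gamma\Big(\sum_{i=1}^n x_i\bm a_i\bm a_i^\top;\lambda\Big)+\frac{d-\tilde k}{\lambda}\;:\;\bm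 x\in[0,1]^n,\ \sum_{i=1}^n x_i=k\Big\}$$ be the optimal value of the convex relaxation. Then $$1\le\frac{z_k}{\nu^{\mathrm N}_k}\le\min\Big\{\frac{d-1}{d-k},\,n-k+1\Big\}\quad\text{if }1\le k\le d-1,$$ $$1\le\frac{z_k}{\nu^{\mathrm N}_k}\le\min\{d,\,n-d+1\}\quad\text{if }k=d,$$ $$1\le\frac{z_k}{\nu^{\mathrm N}_k}\le\frac{n-d+1}{k-d+1}\quad\text{if }d+1\le k\le n.$$ In particular, for every $k\in[n]$ the gap $z_k/\nu^{\mathrm N}_k$ is bounded by a quantity that depends only on $n$, $d$ and $k$. -/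

import Mathlib

noncomputable section

namespace RAOD

/-- The convex envelope of `f` on the set `s`: the pointwise largest function that is convex
on `s` and lies below `f` on `s`. -/
def convexEnvelope {E : Type*} [AddCommGroup E] [Module ℝ E] (s : Set E) (f : E → ℝ) (x : E) : ℝ :=
  sSup {t : ℝ | ∃ g : E → ℝ, ConvexOn ℝ s g ∧ (∀ y ∈ s, g y ≤ f y) ∧ g x = t}

/-- The cone of positive semidefinite real symmetric `d × d` matrices. -/
def psdCone (d : ℕ) : Set (Matrix (Fin d) (Fin d) ℝ) :=
  {X | X.PosSemidef}

open Classical in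
/-- `Γ(X; lam)`: the sum of `1 / (σ_i + lam)` over the `min k d` largest eigenvalues `σ_i` of the
symmetric matrix `X` (`eigenvalues₀` lists the eigenvalues, with multiplicity, in decreasing order).
It is set to `0` at matrices that are not symmetric, which play no role. -/
def Gamma {d : ℕ} (k : ℕ) (lam : ℝ) (X : Matrix (Fin d) (Fin d) ℝ) : ℝ :=
  if hX : X.IsHermitian then
    ∑ i : Fin (min k d), 1 / (hX.eigenvalues₀ (Fin.castLE (by simp) i) + lam)
  else 0

/-- `conv Γ(X; lam)`: the convex envelope of `Γ` on the cone of positive semidefinite matrices. -/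
def convGamma {d : ℕ} (k : ℕ) (lam : ℝ) (X : Matrix (Fin d) (Fin d) ℝ) : ℝ :=
  convexEnvelope (psdCone d) (Gamma k lam) X

/-- The objective `f(S) = tr ((∑_{i ∈ S} a_i a_iᵀ + lam I)⁻¹)`. -/
def objective {n d : ℕ} (a : Fin n → Fin d → ℝ) (lam : ℝ) (S : Finset (Fin n)) : ℝ :=
  ((∑ i ∈ S, Matrix.vecMulVec (a i) (a i) + lam • (1 : Matrix (Fin d) (Fin d) ℝ))⁻¹).trace

/-- The optimal value `z_k`: the minimum of `f(S)` over the `k`-element sets `S`. -/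
def optVal {n d : ℕ} (a : Fin n → Fin d → ℝ) (lam : ℝ) (k : ℕ) : ℝ :=
  sInf {t : ℝ | ∃ S : Finset (Fin n), S.card = k ∧ objective a lam S = t}

/-- The feasible set of the continuous relaxation. -/
def relaxedDomain (n k : ℕ) : Set (Fin n → ℝ) :=
  {x | (∀ i, 0 ≤ x i ∧ x i ≤ 1) ∧ ∑ i, x i = (k : ℝ)}

/-- The objective of the relaxation: `conv Γ (∑ x_i a_i a_iᵀ; lam) + (d - min k d) / lam`. -/
def relaxedObjective {n d : ℕ} (a : Fin n → Fin d → ℝ) (lam : ℝ) (k : ℕ) (x : Fin n → ℝ) : ℝ :=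
  convGamma k lam (∑ i, x i • Matrix.vecMulVec (a i) (a i))
    + ((d : ℝ) - ((min k d : ℕ) : ℝ)) / lam

/-- The optimal value `ν_k` of the relaxation. -/
def relaxedVal {n d : ℕ} (a : Fin n → Fin d → ℝ) (lam : ℝ) (k : ℕ) : ℝ :=
  sInf {t : ℝ | ∃ x ∈ relaxedDomain n k, relaxedObjective a lam k x = t}

end RAOD

end

/-! The bound 1 holds because the relaxation is exact at indicator vectors: a sum of k rank-one
matrices has at most `min k d` nonzero eigenvalues, and every remaining eigenvalue contributes 1/λ.
For an upper bound c it is enough that z_k ≤ c · (relaxed objective) at every feasible x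
(`ratio_bounds`).

Let k = m + 1 ≤ d and x ≤ y ≤ 1. Draw a k-set S with probability proportional to ∏_{i∈S} y_i ·
det(S), where det(S) = det(∑_{i∈S} a_i a_iᵀ + λI). Since λ det(S) (f(S) − (d−k)/λ) = ∑_{i∈S}
det(S∖i) (`det_mul_objective`), the mean of f(S) − (d−k)/λ is at most c · W_m/(λ W_{m+1}), where W_j
is the total weight of the j-sets and c bounds the y-mass outside an m-set. Taking y = x gives c =
k; taking y = 1 gives c = n − k + 1. Up to powers of λ the weights are principal minors of the
lifted Gram matrix, so W_m/(λ W_{m+1}) = e_m(κ)/e_{m+1}(κ) for its eigenvalues κ. A supergradient of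
e_{m+1}/e_m at κ (`exists_supergradient`), fed through trace inequalities, yields an affine minorant
of Γ whose value at ∑ x_i a_i a_iᵀ is at least this ratio (`weightSum_div_le_convGamma`). For k < d,
combining c = k with f ≤ d/λ gives (d−1)/(d−k).

For k > d, Γ(X) = tr((X + λI)⁻¹). Its tangent plane at the full information matrix shows that conv Γ
≥ f([n]) at feasible points, and greedy deletion from [n] down to k elements loses factors that
telescope to (n−d+1)/(k−d+1). -/

namespace RAOD

open Finset Matrix

/-! ### Elementary symmetric polynomials and a supergradient of e_{m+1}/e_m -/

/-- Elementary symmetric polynomial of degree `m` in the variables indexed by `J`. -/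
def esym {ι : Type*} (κ : ι → ℝ) (m : ℕ) (J : Finset ι) : ℝ :=
  ∑ T ∈ J.powersetCard m, ∏ i ∈ T, κ i

/-- Double counting through the bijection (S, i ∈ S) ↔ (S∖i, i). It serves both the recursion for
`esym` and the averaging over sampled sets. -/
theorem sum_powersetCard_succ_erase {ι M : Type*} [DecidableEq ι] [AddCommMonoid M]
    (J : Finset ι) (m : ℕ) (F : ι → Finset ι → M) :
    ∑ S ∈ J.powersetCard (m + 1), ∑ i ∈ S, F i (S.erase i)
      = ∑ T ∈ J.powersetCard m, ∑ i ∈ J \ T, F i T := by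
  rw [sum_sigma', sum_sigma']
  refine sum_bij' (fun p _ => ⟨p.1.erase p.2, p.2⟩) (fun p _ => ⟨insert p.2 p.1, p.2⟩) ?_ ?_ ?_ ?_ ?_
  · rintro ⟨S, i⟩ h
    simp only [mem_sigma, mem_powersetCard, mem_sdiff] at h ⊢
    obtain ⟨⟨hS, hc⟩, hi⟩ := h
    exact ⟨⟨(erase_subset _ _).trans hS, by rw [card_erase_of_mem hi, hc]; rfl⟩, hS hi,
      notMem_erase i S⟩
  · rintro ⟨T, i⟩ h
    simp only [mem_sigma, mem_powersetCard, mem_sdiff] at h ⊢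
    obtain ⟨⟨hT, hc⟩, hi, hiT⟩ := h
    exact ⟨⟨insert_subset hi hT, by rw [card_insert_of_notMem hiT, hc]⟩, mem_insert_self _ _⟩
  · rintro ⟨S, i⟩ h
    simp only [mem_sigma] at h
    simp [insert_erase h.2]
  · rintro ⟨T, i⟩ h
    simp only [mem_sigma, mem_sdiff] at h
    simp [erase_insert h.2.2]
  · rintro ⟨S, i⟩ h
    rfl

theorem sum_powersetCard_sdiff {ι M : Type*} [DecidableEq ι] [AddCommMonoid M]
    (J : Finset ι) (m : ℕ) (F : ι → Finset ι → M) :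
    ∑ T ∈ J.powersetCard m, ∑ i ∈ J \ T, F i T
      = ∑ i ∈ J, ∑ T ∈ (J.erase i).powersetCard m, F i T := by
  refine sum_comm' ?_
  intro T i
  simp only [mem_powersetCard, mem_sdiff, subset_erase]
  tauto

theorem esym_zero {ι : Type*} (κ : ι → ℝ) (J : Finset ι) : esym κ 0 J = 1 := by
  simp [esym]

theorem esym_one {ι : Type*} (κ : ι → ℝ) (J : Finset ι) : esym κ 1 J = ∑ i ∈ J, κ i := by
  simp [esym, powersetCard_one]

theorem esym_nonneg {ι : Type*} {κ : ι → ℝ} {m : ℕ} {J : Finset ι} (h : ∀ i ∈ J, 0 ≤ κ i) :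
    0 ≤ esym κ m J :=
  sum_nonneg fun _ hT => prod_nonneg fun i hi => h i ((mem_powersetCard.1 hT).1 hi)

theorem mul_esym_succ {ι : Type*} [DecidableEq ι] (κ : ι → ℝ) (m : ℕ) (J : Finset ι) :
    ((m : ℝ) + 1) * esym κ (m + 1) J = ∑ i ∈ J, κ i * esym κ m (J.erase i) := by
  have h := (sum_powersetCard_succ_erase J m (fun i T => κ i * ∏ j ∈ T, κ j)).trans
    (sum_powersetCard_sdiff J m _)
  simp only [esym, mul_sum]
  rw [← h]
  refine sum_congr rfl fun S hS => ?_
  rw [sum_congr rfl fun i hi => mul_prod_erase S κ hi, sum_const, (mem_powersetCard.1 hS).2]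
  simp

theorem esym_succ_erase {ι : Type*} [DecidableEq ι] (κ : ι → ℝ) (m : ℕ) {J : Finset ι} {i : ι}
    (hi : i ∈ J) :
    esym κ (m + 1) J = esym κ (m + 1) (J.erase i) + κ i * esym κ m (J.erase i) := by
  conv_lhs => rw [esym, ← insert_erase hi]
  have hni := notMem_erase i J
  rw [powersetCard_succ_insert hni, sum_union, sum_image]
  · simp only [esym, mul_sum]
    congr 1
    refine sum_congr rfl fun T hT => ?_
    rw [prod_insert fun h => hni ((mem_powersetCard.1 hT).1 h)]
  · intro S hS T hT h
    have hS' : i ∉ S := fun h => hni ((mem_powersetCard.1 (mem_coe.1 hS)).1 h)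
    have hT' : i ∉ T := fun h => hni ((mem_powersetCard.1 (mem_coe.1 hT)).1 h)
    rw [← erase_insert hS', ← erase_insert hT', h]
  · rw [disjoint_left]
    intro S hS hS'
    obtain ⟨T, -, rfl⟩ := mem_image.1 hS'
    exact hni ((mem_powersetCard.1 hS).1 (mem_insert_self _ _))

/-- Removing one variable: positivity of `e_{m+1}` passes to `e_m` of the remaining variables. -/
theorem esym_erase_pos {ι : Type*} [DecidableEq ι] {κ : ι → ℝ} {m : ℕ} {J : Finset ι}
    (h0 : ∀ i ∈ J, 0 ≤ κ i) (h : 0 < esym κ (m + 1) J) (i : ι) : 0 < esym κ m (J.erase i) := by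
  obtain ⟨T, hT, hpos⟩ := exists_lt_of_sum_lt (s := J.powersetCard (m + 1)) (f := fun _ => (0 : ℝ))
    (g := fun T => ∏ i ∈ T, κ i) (by simpa [esym] using h)
  obtain ⟨hTJ, hTc⟩ := mem_powersetCard.1 hT
  have hTpos : ∀ j ∈ T, 0 < κ j := fun j hj =>
    lt_of_le_of_ne (h0 j (hTJ hj)) fun hz => hpos.ne' (prod_eq_zero hj hz.symm)
  obtain ⟨R, hR, hRc⟩ := exists_subset_card_eq (s := T.erase i) (n := m)
    (by have := pred_card_le_card_erase (s := T) (a := i); omega)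
  refine sum_pos' (fun S hS => prod_nonneg fun j hj =>
    h0 j (mem_of_mem_erase ((mem_powersetCard.1 hS).1 hj))) ⟨R, ?_, ?_⟩
  · exact mem_powersetCard.2 ⟨hR.trans (erase_subset_erase i hTJ), hRc⟩
  · exact prod_pos fun j hj => hTpos j (mem_of_mem_erase (hR hj))

/-- A supergradient of the concave function `e_{m+1} / e_m` at `κ`, bounded below on vectors
supported on `m + 1` coordinates. -/
theorem exists_supergradient {ι : Type*} [DecidableEq ι] (κ : ι → ℝ) (m : ℕ) :
    ∀ J : Finset ι, (∀ i ∈ J, 0 ≤ κ i) → 0 < esym κ m J →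
      ∃ γ : ι → ℝ, (∀ i, 0 ≤ γ i) ∧ ∑ i ∈ J, γ i * κ i ≤ esym κ (m + 1) J / esym κ m J ∧
        ∀ I ⊆ J, I.card = m + 1 → ∀ t : ι → ℝ, (∀ i ∈ I, 0 < t i) →
          (∑ i ∈ I, 1 / t i)⁻¹ ≤ ∑ i ∈ I, γ i * t i := by
  induction m with
  | zero =>
    intro J _ _
    refine ⟨fun _ => 1, fun _ => zero_le_one, by simp [esym_zero, esym_one], ?_⟩
    intro I _ hI t _
    obtain ⟨i, rfl⟩ := card_eq_one.1 hI
    simp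
  | succ m ih =>
    intro J h0 hpos
    have h0' : ∀ i, ∀ j ∈ J.erase i, 0 ≤ κ j := fun i j hj => h0 j (mem_of_mem_erase hj)
    have hp := esym_erase_pos h0 hpos
    choose γ hγ0 hγκ hγt using fun i => ih (J.erase i) (h0' i) (hp i)
    set q : ι → ℝ := fun i => esym κ (m + 1) (J.erase i) / esym κ m (J.erase i) with hq
    have hq0 : ∀ i, 0 ≤ q i := fun i => div_nonneg (esym_nonneg (h0' i)) (hp i).le
    have hsum : ∀ i ∈ J, esym κ (m + 1) J = (q i + κ i) * esym κ m (J.erase i) := by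
      intro i hi
      rw [esym_succ_erase κ m hi, hq, add_mul, div_mul_cancel₀ _ (hp i).ne']
    have hqk : ∀ i ∈ J, 0 < κ i + q i := by
      intro i hi
      have := hsum i hi
      rw [add_comm]
      exact pos_of_mul_pos_left (this ▸ hpos) (hp i).le
    -- The recursions for `esym` give (m+2) e_{m+2}/e_{m+1} = ∑_i κ_i q_i/(κ_i + q_i), and each
    -- summand is the minimum over θ of θ²κ_i + (1−θ)²q_i, attained here. Freezing θ and replacing
    -- each q_i by its linear majorant from the induction hypothesis makes the whole expression
    -- linear.
    set θ : ι → ℝ := fun i => q i / (κ i + q i) with hθ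
    have hm : (0 : ℝ) < (m : ℝ) + 2 := by positivity
    have key : ∀ t : ι → ℝ, ∑ j ∈ J, (1 / ((m : ℝ) + 2) *
        (θ j ^ 2 + ∑ i ∈ J.erase j, (1 - θ i) ^ 2 * γ i j)) * t j
        = 1 / ((m : ℝ) + 2) *
          ∑ i ∈ J, (θ i ^ 2 * t i + (1 - θ i) ^ 2 * ∑ j ∈ J.erase i, γ i j * t j) := by
      intro t
      have hc : ∑ j ∈ J, ∑ i ∈ J.erase j, (1 - θ i) ^ 2 * γ i j * t j
          = ∑ i ∈ J, ∑ j ∈ J.erase i, (1 - θ i) ^ 2 * γ i j * t j := by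
        refine sum_comm' ?_
        intro j i
        simp only [mem_erase]
        tauto
      simp only [mul_sum, mul_add, add_mul, sum_add_distrib, sum_mul] at hc ⊢
      congr 1
      · exact sum_congr rfl fun _ _ => by ring
      · have := congrArg (fun x => 1 / ((m : ℝ) + 2) * x) hc
        simp only [mul_sum] at this
        simpa only [mul_assoc] using this
    refine ⟨fun j => 1 / ((m : ℝ) + 2) * (θ j ^ 2 + ∑ i ∈ J.erase j, (1 - θ i) ^ 2 * γ i j),
      fun j => ?_, ?_, ?_⟩
    · have : 0 ≤ ∑ i ∈ J.erase j, (1 - θ i) ^ 2 * γ i j :=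
        sum_nonneg fun i _ => mul_nonneg (sq_nonneg _) (hγ0 i j)
      positivity
    · rw [key κ]
      have h1 : ∀ i ∈ J, θ i ^ 2 * κ i + (1 - θ i) ^ 2 * ∑ j ∈ J.erase i, γ i j * κ j
          ≤ κ i * esym κ (m + 1) (J.erase i) / esym κ (m + 1) J := by
        intro i hi
        have hne := (hqk i hi).ne'
        have hne' := (hp i).ne'
        calc _ ≤ θ i ^ 2 * κ i + (1 - θ i) ^ 2 * q i := by
              gcongr
              exact hγκ i
          _ = κ i * q i / (κ i + q i) := by
              simp only [hθ]
              field_simp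
              ring
          _ = _ := by
              rw [hsum i hi, show esym κ (m + 1) (J.erase i) = q i * esym κ m (J.erase i) by
                simp only [hq]; field_simp, ← mul_assoc, add_comm (q i), mul_div_mul_right _ _ hne']
      have h2 := sum_le_sum h1
      have h3 := mul_esym_succ κ (m + 1) J
      push_cast at h3
      rw [← sum_div, ← h3] at h2
      rw [one_div_mul_eq_div, div_le_iff₀ hm]
      refine h2.trans (le_of_eq ?_)
      ring
    · intro I hIJ hIc t ht
      set s : ι → ℝ := fun i => if i ∈ I then t i else 0 with hs
      have hs0 : ∀ i, 0 ≤ s i := by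
        intro i
        simp only [hs]
        split_ifs with h
        · exact (ht i h).le
        · exact le_rfl
      have hext : ∀ (g : ι → ℝ) (A B : Finset ι), A ⊆ B → (∀ i ∈ B, i ∈ I → i ∈ A) → A ⊆ I →
          ∑ i ∈ A, g i * t i = ∑ i ∈ B, g i * s i := by
        intro g A B hAB hB hAI
        rw [← sum_subset hAB fun i hi hiA => by
          simp only [hs, if_neg fun h => hiA (hB i hi h), mul_zero]]
        exact sum_congr rfl fun i hi => by simp [hs, hAI hi]
      rw [hext _ I J hIJ (fun _ _ h => h) subset_rfl, key s]
      set H := (∑ i ∈ I, 1 / t i)⁻¹ with hH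
      -- H is the parallel sum of t_i and the harmonic quantity of `I.erase i`, hence at most θ²t_i
      -- + (1−θ)²u⁻¹ for every θ, in particular for the one frozen at κ.
      have hterm : ∀ i ∈ I, H ≤ θ i ^ 2 * s i + (1 - θ i) ^ 2 * ∑ j ∈ J.erase i, γ i j * s j := by
        intro i hi
        have hci : (I.erase i).card = m + 1 := by rw [card_erase_of_mem hi, hIc]; rfl
        have hti := ht i hi
        have hb := hγt i (I.erase i) (erase_subset_erase i hIJ) hci t
          fun j hj => ht j (mem_of_mem_erase hj)
        rw [hext (γ i) (I.erase i) (J.erase i) (erase_subset_erase i hIJ)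
          (fun j hj hjI => mem_erase.2 ⟨ne_of_mem_erase hj, hjI⟩) (erase_subset _ _)] at hb
        have hne : (I.erase i).Nonempty := card_pos.1 (by omega)
        have hU : 0 < ∑ j ∈ I.erase i, 1 / t j :=
          sum_pos (fun j hj => one_div_pos.2 (ht j (mem_of_mem_erase hj))) hne
        have hHe : H = (1 / t i + ∑ j ∈ I.erase i, 1 / t j)⁻¹ := by
          rw [hH, ← add_sum_erase I (fun j => 1 / t j) hi]
        set u := ∑ j ∈ I.erase i, 1 / t j
        have hsi : s i = t i := by simp [hs, hi]
        calc H ≤ θ i ^ 2 * t i + (1 - θ i) ^ 2 * u⁻¹ := by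
              rw [hHe, ← sub_nonneg]
              have : θ i ^ 2 * t i + (1 - θ i) ^ 2 * u⁻¹ - (1 / t i + u)⁻¹
                  = (θ i * (t i * u + 1) - 1) ^ 2 / (u * (1 + t i * u)) := by
                field_simp
                ring
              rw [this]
              positivity
          _ ≤ _ := by
              rw [hsi]
              gcongr
      have hcard : ((m : ℝ) + 2) * H = ∑ _i ∈ I, H := by
        rw [sum_const, hIc, nsmul_eq_mul]; push_cast; ring
      rw [one_div_mul_eq_div, le_div_iff₀ hm, mul_comm, hcard]
      -- The m + 2 terms with i ∈ I already suffice; those outside I are nonnegative.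
      refine (sum_le_sum hterm).trans (sum_le_sum_of_subset_of_nonneg hIJ fun i hi _ => ?_)
      have : 0 ≤ ∑ j ∈ J.erase i, γ i j * s j :=
        sum_nonneg fun j _ => mul_nonneg (hγ0 i j) (hs0 j)
      have := hs0 i
      positivity

/-! ### Rearrangement inequalities -/

/-- A fractional selection of total weight at least `|J|` weighs at least as much as `J`, if `J`
consists of the smallest weights. -/
theorem sum_le_sum_mul_of_smallest {ι : Type*} [Fintype ι] [DecidableEq ι] {γ c : ι → ℝ}
    {J : Finset ι} (hJ : ∀ i ∈ J, ∀ l ∉ J, γ i ≤ γ l) (hγ : ∀ i, 0 ≤ γ i) (hc0 : ∀ i, 0 ≤ c i)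
    (hc1 : ∀ i, c i ≤ 1) (hc : (J.card : ℝ) ≤ ∑ i, c i) : ∑ i ∈ J, γ i ≤ ∑ i, γ i * c i := by
  rcases J.eq_empty_or_nonempty with rfl | hne
  · simpa using sum_nonneg fun i _ => mul_nonneg (hγ i) (hc0 i)
  -- The largest weight on J is a threshold: γ_i − γ_τ and c_i − 1_J(i) never have opposite signs.
  obtain ⟨τ, hτ, hmax⟩ := exists_max_image J γ hne
  have h1 : ∀ i, γ τ * (c i - if i ∈ J then 1 else 0) ≤ γ i * (c i - if i ∈ J then 1 else 0) := by
    intro i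
    split_ifs with hi
    · nlinarith [hmax i hi, hc1 i]
    · nlinarith [hJ τ hτ i hi, hc0 i]
  have h2 := sum_le_sum fun i (_ : i ∈ (univ : Finset ι)) => h1 i
  rw [← mul_sum] at h2
  simp only [mul_sub, sum_sub_distrib, mul_ite, mul_one, mul_zero, sum_ite_mem, univ_inter] at h2
  rw [sum_const, nsmul_eq_mul, mul_one] at h2
  nlinarith [mul_nonneg (hγ τ) (sub_nonneg.2 hc)]

/-- Abel summation: nonnegative partial sums and antitone nonnegative weights. -/
theorem sum_range_mul_nonneg {σ b : ℕ → ℝ} {m : ℕ} (hσ : ∀ i j, i ≤ j → j < m → σ j ≤ σ i)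
    (hσ0 : ∀ i < m, 0 ≤ σ i) (hb : ∀ l ≤ m, 0 ≤ ∑ i ∈ range l, b i) :
    0 ≤ ∑ i ∈ range m, σ i * b i := by
  have key : ∀ l, l < m → σ l * ∑ i ∈ range (l + 1), b i ≤ ∑ i ∈ range (l + 1), σ i * b i := by
    intro l
    induction l with
    | zero => intro _; simp
    | succ l ih =>
      intro hl
      rw [sum_range_succ, sum_range_succ _ (l + 1), mul_add]
      have h1 := ih (by omega)
      have h2 := mul_le_mul_of_nonneg_right (hσ l (l + 1) (by omega) hl) (hb (l + 1) (by omega))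
      linarith
  rcases m with _ | m
  · simp
  · exact (mul_nonneg (hσ0 m (by omega)) (hb _ le_rfl)).trans (key m (by omega))

/-- The trace inequality `∑ γ_j σ_j ≤ tr (G Y)` for oppositely ordered eigenvalues, in terms of the
weights `f j i = σ_j ⟨u_i, v_j⟩²`. -/
theorem sum_mul_le_sum_weights {n d : ℕ} (hdn : d ≤ n) {γ : Fin n → ℝ} {σ : Fin d → ℝ}
    (hγ : Monotone γ) (hγ0 : ∀ i, 0 ≤ γ i) (hσ : Antitone σ) (hσ0 : ∀ j, 0 ≤ σ j)
    {f : Fin d → Fin n → ℝ} (hf0 : ∀ j i, 0 ≤ f j i) (hf : ∀ j, ∑ i, f j i = σ j)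
    (hf1 : ∀ i, ∑ j, f j i / σ j ≤ 1) :
    ∑ j, γ (Fin.castLE hdn j) * σ j ≤ ∑ i, γ i * ∑ j, f j i := by
  -- The excess at j after normalizing the row f j to total mass 1. When σ_j = 0 that row vanishes,
  -- so the value 0 loses nothing.
  set b : Fin d → ℝ := fun j =>
    if σ j = 0 then 0 else ∑ i, γ i * (f j i / σ j) - γ (Fin.castLE hdn j) with hb
  have hsum : ∑ i, γ i * ∑ j, f j i - ∑ j, γ (Fin.castLE hdn j) * σ j = ∑ j, σ j * b j := by
    have : ∀ j, σ j * b j = ∑ i, γ i * f j i - γ (Fin.castLE hdn j) * σ j := by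
      intro j
      by_cases h : σ j = 0
      · have hz : ∀ i, f j i = 0 := fun i =>
          (sum_eq_zero_iff_of_nonneg fun i _ => hf0 j i).1 ((hf j).trans h) i (mem_univ i)
        simp [h, hz]
      · simp only [hb, if_neg h, mul_sub, mul_sum]
        congr 1
        · refine sum_congr rfl fun i _ => ?_
          field_simp
        · ring
    simp only [this, sum_sub_distrib, mul_sum]
    rw [sum_comm]
  rw [← sub_nonneg, hsum]
  set σ' : ℕ → ℝ := fun j => if h : j < d then σ ⟨j, h⟩ else 0 with hσ'
  set b' : ℕ → ℝ := fun j => if h : j < d then b ⟨j, h⟩ else 0 with hb'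
  have hconv : ∑ j, σ j * b j = ∑ j ∈ range d, σ' j * b' j := by
    rw [Finset.sum_range]
    exact sum_congr rfl fun j _ => by simp [hσ', hb']
  rw [hconv]
  refine sum_range_mul_nonneg ?_ ?_ ?_
  · intro i j hij hj
    simp only [hσ', hj, lt_of_le_of_lt hij hj, dif_pos]
    exact hσ hij
  · intro i hi
    simp only [hσ', hi, dif_pos]
    exact hσ0 _
  · intro l hl
    -- As σ is antitone, A is an initial segment. The normalized rows in A add up to a fractional
    -- selection of mass |A| with entries at most 1, so the partial sum of b is nonnegative.
    set A : Finset (Fin d) := univ.filter fun j => j.1 < l ∧ σ j ≠ 0 with hA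
    have hpart : ∑ j ∈ range l, b' j = ∑ j ∈ A, b j := by
      have e1 : ∑ j ∈ range l, b' j = ∑ j ∈ range d, if j < l then b' j else 0 := by
        rw [← sum_filter]
        congr 1
        ext j
        simp only [mem_range, mem_filter]
        omega
      rw [e1, Finset.sum_range, hA, sum_filter]
      refine sum_congr rfl fun j _ => ?_
      by_cases h1 : j.1 < l <;> by_cases h2 : σ j = 0 <;> simp [h1, h2, hb', hb]
      rfl
    have hAb : ∑ j ∈ A, b j
        = ∑ i, γ i * ∑ j ∈ A, f j i / σ j - ∑ j ∈ A, γ (Fin.castLE hdn j) := by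
      have : ∀ j ∈ A, b j = ∑ i, γ i * (f j i / σ j) - γ (Fin.castLE hdn j) := by
        intro j hj
        simp only [hb, if_neg (mem_filter.1 hj).2.2]
      rw [sum_congr rfl this, sum_sub_distrib, sum_comm]
      simp only [mul_sum]
    rw [hpart, hAb, sub_nonneg]
    have hinj : Function.Injective (Fin.castLE hdn) := Fin.castLE_injective hdn
    have := sum_le_sum_mul_of_smallest (γ := γ) (c := fun i => ∑ j ∈ A, f j i / σ j)
      (J := A.image (Fin.castLE hdn)) ?_ hγ0
      (fun i => sum_nonneg fun j _ => div_nonneg (hf0 j i) (hσ0 j))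
      (fun i => (sum_le_sum_of_subset_of_nonneg (subset_univ A)
        fun j _ _ => div_nonneg (hf0 j i) (hσ0 j)).trans (hf1 i)) ?_
    · rwa [sum_image fun x _ y _ h => hinj h] at this
    · intro i hi m hm
      obtain ⟨j, hj, rfl⟩ := mem_image.1 hi
      apply hγ
      by_contra hlt
      push Not at hlt
      have hlt' : m.1 < j.1 := hlt
      refine hm (mem_image.2 ⟨⟨m.1, by omega⟩, ?_, rfl⟩)
      obtain ⟨-, h1, h2⟩ := mem_filter.1 hj
      refine mem_filter.2 ⟨mem_univ _, show m.1 < l by omega, fun h => h2 ?_⟩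
      exact le_antisymm (h ▸ hσ (show (⟨m.1, by omega⟩ : Fin d) ≤ j from hlt'.le)) (hσ0 j)
    · rw [card_image_of_injective _ hinj, sum_comm]
      refine le_of_eq ?_
      have : ∀ j ∈ A, ∑ i, f j i / σ j = 1 := by
        intro j hj
        rw [← sum_div, hf j, div_self (mem_filter.1 hj).2.2]
      rw [sum_congr rfl this]
      simp

/-! ### Spectral form and trace inequalities -/

theorem exists_spectral {d : ℕ} {X : Matrix (Fin d) (Fin d) ℝ} (hX : X.PosSemidef) :
    ∃ (U : Matrix (Fin d) (Fin d) ℝ) (σ : Fin d → ℝ), Uᵀ * U = 1 ∧ U * Uᵀ = 1 ∧ Antitone σ ∧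
      (∀ j, 0 ≤ σ j) ∧ X = U * diagonal σ * Uᵀ ∧
      ∀ k lam, Gamma k lam X
        = ∑ i : Fin (min k d), 1 / (σ (Fin.castLE (min_le_right k d) i) + lam) := by
  have hH := hX.isHermitian
  -- `eigenvalues` is `eigenvalues₀` transported along a chosen equivalence; π undoes it, so that
  -- the columns follow the decreasing order.
  let π : Fin d ≃ Fin d := (finCongr (Fintype.card_fin d).symm).trans
    (Fintype.equivOfCardEq (Fintype.card_fin _))
  let V : Matrix (Fin d) (Fin d) ℝ := hH.eigenvectorUnitary
  have hV1 : Vᵀ * V = 1 := by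
    have := Unitary.coe_star_mul_self hH.eigenvectorUnitary
    simpa [star_eq_conjTranspose] using this
  have hV2 : V * Vᵀ = 1 := mul_eq_one_comm.1 hV1
  let σ : Fin d → ℝ := fun j => hH.eigenvalues₀ (Fin.cast (Fintype.card_fin d).symm j)
  have hσ : σ = hH.eigenvalues ∘ π := by
    ext j
    simp only [σ, IsHermitian.eigenvalues, Function.comp, π, Equiv.trans_apply]
    rw [Equiv.symm_apply_apply]
    rfl
  have hU1 : (V.submatrix id π)ᵀ * V.submatrix id π = 1 := by
    rw [transpose_submatrix, submatrix_mul _ _ π id π Function.bijective_id |>.symm, hV1,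
      submatrix_one_equiv]
  refine ⟨V.submatrix id π, σ, hU1, mul_eq_one_comm.1 hU1, ?_, ?_, ?_, ?_⟩
  · intro i j hij
    exact hH.eigenvalues₀_antitone hij
  · intro j
    rw [hσ]
    exact hX.eigenvalues_nonneg _
  · have h1 : X = V * diagonal hH.eigenvalues * Vᵀ := by
      have := hH.spectral_theorem
      simpa [Unitary.conjStarAlgAut_apply, star_eq_conjTranspose, Function.comp_def] using this
    rw [hσ, ← submatrix_diagonal_equiv, transpose_submatrix, submatrix_mul_equiv,
      submatrix_mul_equiv, submatrix_id_id]
    exact h1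
  · intro k lam
    simp only [Gamma, hH, dif_pos]
    rfl

theorem trace_mul_conj_diagonal {n d : ℕ} (U : Matrix (Fin d) (Fin n) ℝ) (γ : Fin n → ℝ)
    (V : Matrix (Fin d) (Fin d) ℝ) (σ : Fin d → ℝ) :
    (V * diagonal σ * Vᵀ * (U * diagonal γ * Uᵀ)).trace
      = ∑ i, γ i * ∑ j, σ j * (Vᵀ * U) j i ^ 2 := by
  have : (V * diagonal σ * Vᵀ * (U * diagonal γ * Uᵀ)).trace
      = (diagonal σ * (Vᵀ * U) * diagonal γ * (Vᵀ * U)ᵀ).trace := by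
    rw [transpose_mul, transpose_transpose]
    simp only [Matrix.mul_assoc]
    rw [trace_mul_comm]
    simp only [Matrix.mul_assoc]
  rw [this, trace]
  simp only [diag_apply, mul_apply (M := diagonal σ * (Vᵀ * U) * diagonal γ), mul_diagonal,
    diagonal_mul, transpose_apply, mul_sum]
  rw [sum_comm]
  exact sum_congr rfl fun i _ => sum_congr rfl fun j _ => by ring

/-- The trace inequality for two positive semidefinite matrices in spectral form. -/
theorem sum_mul_le_trace {d : ℕ} {U V : Matrix (Fin d) (Fin d) ℝ} {γ σ : Fin d → ℝ}
    (hU : U * Uᵀ = 1) (hV : V * Vᵀ = 1) (hγ : Monotone γ) (hγ0 : ∀ i, 0 ≤ γ i)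
    (hσ : Antitone σ) (hσ0 : ∀ j, 0 ≤ σ j) :
    ∑ j, γ j * σ j ≤ (V * diagonal σ * Vᵀ * (U * diagonal γ * Uᵀ)).trace := by
  rw [trace_mul_conj_diagonal]
  have hU' := mul_eq_one_comm.1 hU
  have hV' := mul_eq_one_comm.1 hV
  set P := Vᵀ * U with hP
  have h1 : P * Pᵀ = 1 := by
    rw [hP, transpose_mul, transpose_transpose, Matrix.mul_assoc, ← Matrix.mul_assoc U, hU,
      Matrix.one_mul, hV']
  have h2 : Pᵀ * P = 1 := mul_eq_one_comm.1 h1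
  have hrow : ∀ j, ∑ i, P j i ^ 2 = 1 := fun j => by
    simpa [mul_apply, sq] using congrFun (congrFun h1 j) j
  have hcol : ∀ i, ∑ j, P j i ^ 2 = 1 := fun i => by
    simpa [mul_apply, sq] using congrFun (congrFun h2 i) i
  refine sum_mul_le_sum_weights le_rfl hγ hγ0 hσ hσ0 (fun j i => mul_nonneg (hσ0 j) (sq_nonneg _))
    (fun j => by rw [← mul_sum, hrow, mul_one]) fun i => ?_
  rw [← hcol i]
  refine sum_le_sum fun j _ => ?_
  rcases eq_or_ne (σ j) 0 with h | h
  · simp [h, sq_nonneg]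
  · rw [mul_div_cancel_left₀ _ h]

/-- The trace inequality between `C Cᵀ`, given in spectral form, and a matrix acting on the other
side of `C`. -/
theorem sum_mul_le_sum_sq {n d : ℕ} (hdn : d ≤ n) {E : Matrix (Fin d) (Fin n) ℝ}
    {γ : Fin n → ℝ} {σ : Fin d → ℝ} (hE : E * Eᵀ = diagonal σ) (hγ : Monotone γ)
    (hγ0 : ∀ i, 0 ≤ γ i) (hσ : Antitone σ) (hσ0 : ∀ j, 0 ≤ σ j) :
    ∑ j, γ (Fin.castLE hdn j) * σ j ≤ ∑ i, γ i * ∑ j, E j i ^ 2 := by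
  refine sum_mul_le_sum_weights hdn hγ hγ0 hσ hσ0 (fun j i => sq_nonneg _) (fun j => ?_)
    fun i => ?_
  · simpa [mul_apply, sq] using congrFun (congrFun hE j) j
  -- Q is symmetric and idempotent, even when some σ_j = 0, since then the inverse is 0. Hence its
  -- diagonal entries, which are the sums to be bounded, are at most 1.
  · set Q := Eᵀ * diagonal (fun j => (σ j)⁻¹) * E with hQ
    have hQQ : Q * Q = Q := by
      have : diagonal (fun j => (σ j)⁻¹) * diagonal σ * diagonal (fun j => (σ j)⁻¹)
          = diagonal (fun j => (σ j)⁻¹) := by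
        rw [diagonal_mul_diagonal, diagonal_mul_diagonal]
        congr 1
        ext j
        rcases eq_or_ne (σ j) 0 with h | h
        · simp [h]
        · field_simp
      calc Q * Q = Eᵀ * (diagonal (fun j => (σ j)⁻¹) * (E * Eᵀ) * diagonal (fun j => (σ j)⁻¹)) * E := by
            simp only [hQ, Matrix.mul_assoc]
        _ = Q := by rw [hE, this]
    have hQt : Qᵀ = Q := by
      simp [hQ, transpose_mul, Matrix.mul_assoc]
    have hii : Q i i = ∑ l, Q i l ^ 2 := by
      conv_lhs => rw [← hQQ, mul_apply]
      refine sum_congr rfl fun l _ => ?_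
      rw [sq, ← congrFun (congrFun hQt l) i, transpose_apply]
    have hle : Q i i ^ 2 ≤ Q i i := by
      conv_rhs => rw [hii]
      exact single_le_sum (f := fun l => Q i l ^ 2) (fun l _ => sq_nonneg _) (mem_univ i)
    have hval : Q i i = ∑ j, E j i ^ 2 / σ j := by
      rw [hQ, mul_apply]
      refine sum_congr rfl fun j _ => ?_
      rw [mul_diagonal, transpose_apply]
      ring
    rw [← hval]
    nlinarith

/-! ### Regularized information matrices: leverages and determinants -/

/-- The regularized information matrix `∑_{i ∈ S} a_i a_iᵀ + lam I`. -/
def regInfo {n d : ℕ} (a : Fin n → Fin d → ℝ) (lam : ℝ) (S : Finset (Fin n)) :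
    Matrix (Fin d) (Fin d) ℝ :=
  ∑ i ∈ S, vecMulVec (a i) (a i) + lam • (1 : Matrix (Fin d) (Fin d) ℝ)

theorem posSemidef_vecMulVec_self {d : ℕ} (v : Fin d → ℝ) : (vecMulVec v v).PosSemidef := by
  simpa using posSemidef_vecMulVec_self_star v

theorem posSemidef_sum_smul {n d : ℕ} (a : Fin n → Fin d → ℝ) {x : Fin n → ℝ} (hx : ∀ i, 0 ≤ x i) :
    (∑ i, x i • vecMulVec (a i) (a i)).PosSemidef :=
  posSemidef_sum _ fun i _ => (posSemidef_vecMulVec_self (a i)).smul (hx i)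

theorem posDef_smul_one {d : ℕ} {lam : ℝ} (h : 0 < lam) :
    (lam • (1 : Matrix (Fin d) (Fin d) ℝ)).PosDef :=
  PosDef.one.smul h

theorem regInfo_posDef {n d : ℕ} (a : Fin n → Fin d → ℝ) {lam : ℝ} (h : 0 < lam)
    (S : Finset (Fin n)) : (regInfo a lam S).PosDef :=
  PosDef.posSemidef_add (posSemidef_sum _ fun i _ => posSemidef_vecMulVec_self (a i))
    (posDef_smul_one h)

theorem objective_eq {n d : ℕ} (a : Fin n → Fin d → ℝ) (lam : ℝ) (S : Finset (Fin n)) :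
    objective a lam S = ((regInfo a lam S)⁻¹).trace := rfl

theorem regInfo_erase {n d : ℕ} (a : Fin n → Fin d → ℝ) (lam : ℝ) {S : Finset (Fin n)} {i : Fin n}
    (hi : i ∈ S) : regInfo a lam (S.erase i) = regInfo a lam S - vecMulVec (a i) (a i) := by
  rw [regInfo, regInfo, ← add_sum_erase S _ hi]
  abel

theorem det_sub_vecMulVec {d : ℕ} {B : Matrix (Fin d) (Fin d) ℝ} (hB : IsUnit B.det)
    (v : Fin d → ℝ) : (B - vecMulVec v v).det = B.det * (1 - v ⬝ᵥ B⁻¹ *ᵥ v) := by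
  have h := det_add_replicateCol_mul_replicateRow (ι := Unit) hB (-v) v
  rw [← vecMulVec_eq, neg_vecMulVec, ← sub_eq_add_neg] at h
  rw [h]
  congr 1
  rw [det_unique]
  simp [Matrix.mul_assoc, mul_apply, replicateRow_apply, replicateCol_apply, dotProduct,
    mulVec, sub_eq_add_neg]

theorem trace_mul_vecMulVec {d : ℕ} (B : Matrix (Fin d) (Fin d) ℝ) (v : Fin d → ℝ) :
    (B * vecMulVec v v).trace = v ⬝ᵥ B *ᵥ v := by
  rw [mul_vecMulVec, trace_vecMulVec, dotProduct_comm]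

theorem sum_leverage {n d : ℕ} (a : Fin n → Fin d → ℝ) {lam : ℝ} (h : 0 < lam)
    (S : Finset (Fin n)) :
    ∑ i ∈ S, a i ⬝ᵥ (regInfo a lam S)⁻¹ *ᵥ a i = d - lam * objective a lam S := by
  have hB := (isUnit_iff_isUnit_det _).1 (regInfo_posDef a h S).isUnit
  have h1 : ((regInfo a lam S)⁻¹ * (∑ i ∈ S, vecMulVec (a i) (a i)
      + lam • (1 : Matrix (Fin d) (Fin d) ℝ))).trace = trace 1 :=
    congrArg trace (nonsing_inv_mul _ hB)
  rw [objective_eq]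
  rw [Matrix.mul_add, trace_add, Matrix.mul_smul, Matrix.mul_one, trace_smul, Finset.mul_sum,
    trace_sum] at h1
  simp only [trace_mul_vecMulVec] at h1
  simp at h1
  linarith

theorem det_regInfo_pos {n d : ℕ} (a : Fin n → Fin d → ℝ) {lam : ℝ} (h : 0 < lam)
    (S : Finset (Fin n)) : 0 < (regInfo a lam S).det :=
  (regInfo_posDef a h S).det_pos

theorem det_regInfo_erase {n d : ℕ} (a : Fin n → Fin d → ℝ) {lam : ℝ} (h : 0 < lam)
    {S : Finset (Fin n)} {i : Fin n} (hi : i ∈ S) :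
    (regInfo a lam (S.erase i)).det
      = (regInfo a lam S).det * (1 - a i ⬝ᵥ (regInfo a lam S)⁻¹ *ᵥ a i) := by
  rw [regInfo_erase a lam hi, det_sub_vecMulVec (det_regInfo_pos a h S).ne'.isUnit]

theorem leverage_lt_one {n d : ℕ} (a : Fin n → Fin d → ℝ) {lam : ℝ} (h : 0 < lam)
    {S : Finset (Fin n)} {i : Fin n} (hi : i ∈ S) :
    a i ⬝ᵥ (regInfo a lam S)⁻¹ *ᵥ a i < 1 := by
  have h1 := det_regInfo_pos a h (S.erase i)
  rw [det_regInfo_erase a h hi] at h1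
  have := pos_of_mul_pos_right h1 (det_regInfo_pos a h S).le
  linarith

theorem leverage_nonneg {n d : ℕ} (a : Fin n → Fin d → ℝ) {lam : ℝ} (h : 0 < lam)
    (S : Finset (Fin n)) (v : Fin d → ℝ) : 0 ≤ v ⬝ᵥ (regInfo a lam S)⁻¹ *ᵥ v := by
  have := (regInfo_posDef a h S).inv.posSemidef.dotProduct_mulVec_nonneg v
  simpa using this

/-- Each deletion multiplies the determinant by one minus a leverage, and the leverages sum to d − λ
f(S). -/
theorem det_mul_objective {n d : ℕ} (a : Fin n → Fin d → ℝ) {lam : ℝ} (h : 0 < lam)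
    (S : Finset (Fin n)) :
    lam * ((regInfo a lam S).det * (objective a lam S - (d - S.card) / lam))
      = ∑ i ∈ S, (regInfo a lam (S.erase i)).det := by
  rw [sum_congr rfl fun i hi => det_regInfo_erase a h hi, ← mul_sum, sum_sub_distrib,
    sum_leverage a h]
  simp
  field_simp
  ring

theorem objective_pos {n d : ℕ} (hd : 1 ≤ d) (a : Fin n → Fin d → ℝ) {lam : ℝ} (h : 0 < lam)
    (S : Finset (Fin n)) : 0 < objective a lam S := by
  have : Nonempty (Fin d) := ⟨⟨0, hd⟩⟩
  exact (regInfo_posDef a h S).inv.trace_pos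

theorem objective_le {n d : ℕ} (a : Fin n → Fin d → ℝ) {lam : ℝ} (h : 0 < lam)
    (S : Finset (Fin n)) : objective a lam S ≤ d / lam := by
  have h1 := sum_leverage a h S
  have h2 : 0 ≤ ∑ i ∈ S, a i ⬝ᵥ (regInfo a lam S)⁻¹ *ᵥ a i :=
    sum_nonneg fun i _ => leverage_nonneg a h S (a i)
  rw [le_div_iff₀ h]
  linarith

/-- Averaging the objective over `(m + 1)`-sets with weights `∏ y_i det (∑ a_i a_iᵀ + lam I)`. -/
theorem sum_weights_mul_objective {n d : ℕ} (a : Fin n → Fin d → ℝ) {lam : ℝ} (h : 0 < lam)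
    (y : Fin n → ℝ) (m : ℕ) :
    lam * ∑ S ∈ (univ : Finset (Fin n)).powersetCard (m + 1),
        (∏ i ∈ S, y i) * (regInfo a lam S).det * (objective a lam S - (d - (m + 1)) / lam)
      = ∑ T ∈ (univ : Finset (Fin n)).powersetCard m,
        (∏ i ∈ T, y i) * (regInfo a lam T).det * ∑ i ∈ univ \ T, y i := by
  have hF := sum_powersetCard_succ_erase (univ : Finset (Fin n)) m
    (fun i T => (∏ j ∈ T, y j) * (regInfo a lam T).det * y i)
  simp only [← mul_sum] at hF
  rw [← hF, mul_sum]
  refine sum_congr rfl fun S hS => ?_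
  have h1 := det_mul_objective a h S
  rw [(mem_powersetCard.1 hS).2] at h1
  have h2 : ∑ i ∈ S, (∏ j ∈ S.erase i, y j) * (regInfo a lam (S.erase i)).det * y i
      = ∑ i ∈ S, (∏ j ∈ S, y j) * (regInfo a lam (S.erase i)).det :=
    sum_congr rfl fun i hi => by rw [← mul_prod_erase S y hi]; ring
  rw [h2, ← mul_sum, ← h1]
  push_cast
  ring

/-! ### Sampling weights as principal minors of the lifted Gram matrix -/

theorem pow_mul_det_smul_one_add {m n : Type*} [Fintype m] [Fintype n] [DecidableEq m]
    [DecidableEq n] (B : Matrix m n ℝ) {lam : ℝ} (h : lam ≠ 0) :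
    lam ^ Fintype.card m * (Bᵀ * B + lam • (1 : Matrix n n ℝ)).det
      = lam ^ Fintype.card n * (B * Bᵀ + lam • (1 : Matrix m m ℝ)).det := by
  have h1 : Bᵀ * B + lam • (1 : Matrix n n ℝ) = lam • (1 + (lam⁻¹ • Bᵀ) * B) := by
    rw [smul_add, Matrix.smul_mul, smul_inv_smul₀ h, add_comm]
  have h2 : B * Bᵀ + lam • (1 : Matrix m m ℝ) = lam • (1 + B * (lam⁻¹ • Bᵀ)) := by
    rw [smul_add, Matrix.mul_smul, smul_inv_smul₀ h, add_comm]
  rw [h1, h2, det_smul, det_smul, det_one_add_mul_comm]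
  ring

/-- The matrix with columns `√(y_i) a_i`. -/
noncomputable def scaledCols {n d : ℕ} (a : Fin n → Fin d → ℝ) (y : Fin n → ℝ) : Matrix (Fin d) (Fin n) ℝ :=
  of fun r i => √(y i) * a i r

theorem scaledCols_mul_transpose {n d : ℕ} (a : Fin n → Fin d → ℝ) {y : Fin n → ℝ}
    (hy : ∀ i, 0 ≤ y i) :
    scaledCols a y * (scaledCols a y)ᵀ = ∑ i, y i • vecMulVec (a i) (a i) := by
  ext r s
  rw [mul_apply, Matrix.sum_apply]
  refine sum_congr rfl fun i _ => ?_
  simp only [scaledCols, of_apply, transpose_apply, Matrix.smul_apply, vecMulVec_apply, smul_eq_mul]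
  nth_rewrite 3 [← Real.mul_self_sqrt (hy i)]
  ring

/-- The Gram matrix of the vectors `√(y_i) (a_i, √lam e_i)`. -/
noncomputable def liftedGram {n d : ℕ} (a : Fin n → Fin d → ℝ) (lam : ℝ) (y : Fin n → ℝ) :
    Matrix (Fin n) (Fin n) ℝ :=
  (scaledCols a y)ᵀ * scaledCols a y + lam • diagonal y

theorem liftedGram_posSemidef {n d : ℕ} (a : Fin n → Fin d → ℝ) {lam : ℝ} (h : 0 < lam)
    {y : Fin n → ℝ} (hy : ∀ i, 0 ≤ y i) : (liftedGram a lam y).PosSemidef := by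
  refine PosSemidef.add ?_ ((PosSemidef.diagonal hy).smul h.le)
  simpa using posSemidef_conjTranspose_mul_self (scaledCols a y)

/-- The minor factors as D(BᵀB + λI)D with D = diag(√y_i), and Sylvester's identity exchanges BᵀB
for BBᵀ. Powers of λ stand on both sides because neither d nor |T| need be the larger. -/
theorem pow_mul_det_minor {n d : ℕ} (a : Fin n → Fin d → ℝ) {lam : ℝ} (h : 0 < lam)
    {y : Fin n → ℝ} (hy : ∀ i, 0 ≤ y i) (T : Finset (Fin n)) :
    lam ^ d * ((liftedGram a lam y).submatrix (Subtype.val : T → Fin n) Subtype.val).det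
      = lam ^ T.card * ((∏ i ∈ T, y i) * (regInfo a lam T).det) := by
  set B : Matrix (Fin d) T ℝ := of fun r i => a i r with hB
  set D : Matrix T T ℝ := diagonal fun i => √(y i) with hD
  have h1 : (liftedGram a lam y).submatrix (Subtype.val : T → Fin n) Subtype.val
      = D * (Bᵀ * B + lam • (1 : Matrix T T ℝ)) * D := by
    ext i j
    rw [hD, mul_diagonal, diagonal_mul]
    simp only [liftedGram, submatrix_apply, Matrix.add_apply, Matrix.smul_apply, mul_apply, transpose_apply, scaledCols, of_apply, hB, smul_eq_mul,
      diagonal_apply, one_apply, Subtype.val_inj, mul_add, add_mul, mul_sum, sum_mul]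
    congr 1
    · exact sum_congr rfl fun r _ => by ring
    · split_ifs with hij
      · subst hij
        nth_rewrite 1 [← Real.mul_self_sqrt (hy i)]
        ring
      · simp
  have h2 : B * Bᵀ + lam • (1 : Matrix (Fin d) (Fin d) ℝ) = regInfo a lam T := by
    rw [regInfo, ← sum_coe_sort T fun i => vecMulVec (a i) (a i)]
    congr 1
    ext r s
    simp [hB, mul_apply, Matrix.sum_apply, vecMulVec_apply]
  have h3 := pow_mul_det_smul_one_add B h.ne'
  rw [h2, Fintype.card_fin, Fintype.card_coe] at h3
  rw [h1, det_mul, det_mul, hD, det_diagonal]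
  have h4 : (∏ i : T, √(y i)) * ∏ i : T, √(y i) = ∏ i ∈ T, y i := by
    rw [← prod_mul_distrib, ← prod_coe_sort T]
    exact prod_congr rfl fun i _ => Real.mul_self_sqrt (hy i)
  calc _ = ((∏ i : T, √(y i)) * ∏ i : T, √(y i))
        * (lam ^ d * (Bᵀ * B + lam • (1 : Matrix T T ℝ)).det) := by ring
    _ = _ := by
      rw [h4, h3]
      ring

/-- K and `diagonal κ` are similar, so their characteristic polynomials agree, and the coefficients
are signed sums of principal minors. -/
theorem esym_eq_sum_minors {n : ℕ} {K U : Matrix (Fin n) (Fin n) ℝ} {κ : Fin n → ℝ}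
    (hU : Uᵀ * U = 1) (hK : K = U * diagonal κ * Uᵀ) {j : ℕ} (hj : j ≤ n) :
    esym κ j univ = ∑ T ∈ (univ : Finset (Fin n)).powersetCard j,
      (K.submatrix (Subtype.val : T → Fin n) Subtype.val).det := by
  have h1 : K.charpoly = (diagonal κ).charpoly := by
    rw [hK, charpoly_mul_comm, ← Matrix.mul_assoc, hU, Matrix.one_mul]
  have h2 := charpoly_coeff_eq_sum_minors K j (by simpa using hj)
  have h3 := charpoly_coeff_eq_sum_minors (diagonal κ) j (by simpa using hj)
  rw [h1, h3] at h2
  rw [← mul_left_cancel₀ (pow_ne_zero j (by norm_num)) h2, esym]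
  refine sum_congr rfl fun T _ => ?_
  rw [submatrix_diagonal _ _ Subtype.val_injective, det_diagonal, ← prod_coe_sort T]
  rfl

/-- The total weight `∑_{|T| = j} ∏_{i ∈ T} y_i det (∑_{i ∈ T} a_i a_iᵀ + lam I)`. -/
noncomputable def weightSum {n d : ℕ} (a : Fin n → Fin d → ℝ) (lam : ℝ) (y : Fin n → ℝ) (j : ℕ) : ℝ :=
  ∑ T ∈ (univ : Finset (Fin n)).powersetCard j, (∏ i ∈ T, y i) * (regInfo a lam T).det

theorem weightSum_pos {n d : ℕ} (a : Fin n → Fin d → ℝ) {lam : ℝ} (h : 0 < lam) {y : Fin n → ℝ}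
    (hy : ∀ i, 0 ≤ y i) (hy1 : ∀ i, y i ≤ 1) {j : ℕ} (hj : (j : ℝ) ≤ ∑ i, y i) :
    0 < weightSum a lam y j := by
  set P := (univ : Finset (Fin n)).filter fun i => 0 < y i
  have hP : (j : ℝ) ≤ P.card := by
    refine hj.trans ?_
    rw [← sum_filter_add_sum_filter_not univ fun i => 0 < y i]
    have h1 : ∑ i ∈ univ.filter fun i => ¬ 0 < y i, y i ≤ 0 :=
      sum_nonpos fun i hi => not_lt.1 (mem_filter.1 hi).2
    have h2 : ∑ i ∈ P, y i ≤ ∑ i ∈ P, 1 := sum_le_sum fun i _ => hy1 i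
    rw [sum_const, nsmul_eq_mul, mul_one] at h2
    linarith
  obtain ⟨T, hT, hTc⟩ := exists_subset_card_eq (Nat.cast_le.1 hP)
  refine sum_pos' (fun S _ => mul_nonneg (prod_nonneg fun i _ => hy i) (det_regInfo_pos a h S).le)
    ⟨T, mem_powersetCard.2 ⟨subset_univ _, hTc⟩, mul_pos (prod_pos fun i hi => ?_)
      (det_regInfo_pos a h T)⟩
  exact (mem_filter.1 (hT hi)).2

theorem pow_mul_esym_eq {n d : ℕ} (a : Fin n → Fin d → ℝ) {lam : ℝ} (h : 0 < lam)
    {y : Fin n → ℝ} (hy : ∀ i, 0 ≤ y i) {U : Matrix (Fin n) (Fin n) ℝ} {κ : Fin n → ℝ}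
    (hU : Uᵀ * U = 1) (hK : liftedGram a lam y = U * diagonal κ * Uᵀ) {j : ℕ} (hj : j ≤ n) :
    lam ^ d * esym κ j univ = lam ^ j * weightSum a lam y j := by
  rw [esym_eq_sum_minors hU hK hj, weightSum, mul_sum, mul_sum]
  refine sum_congr rfl fun T hT => ?_
  rw [pow_mul_det_minor a h hy, (mem_powersetCard.1 hT).2]

/-! ### The convex envelope and its affine minorants -/

theorem Gamma_nonneg {d : ℕ} (k : ℕ) {lam : ℝ} (h : 0 < lam) {X : Matrix (Fin d) (Fin d) ℝ}
    (hX : X.PosSemidef) : 0 ≤ Gamma k lam X := by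
  obtain ⟨U, σ, -, -, -, hσ, -, hG⟩ := exists_spectral hX
  rw [hG]
  exact sum_nonneg fun i _ => one_div_nonneg.2 (add_nonneg (hσ _) h.le)

theorem convex_psdCone (d : ℕ) : Convex ℝ (psdCone d) := by
  intro X hX Y hY s t hs ht _
  exact (PosSemidef.smul hX hs).add (PosSemidef.smul hY ht)

/-- The value of Γ at X bounds the set of minorant values, so the real `sSup` is a genuine supremum
here. -/
theorem le_convGamma {d k : ℕ} {lam : ℝ} {X : Matrix (Fin d) (Fin d) ℝ} (hX : X.PosSemidef)
    {g : Matrix (Fin d) (Fin d) ℝ → ℝ} (hg : ConvexOn ℝ (psdCone d) g)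
    (hle : ∀ Y ∈ psdCone d, g Y ≤ Gamma k lam Y) : g X ≤ convGamma k lam X :=
  le_csSup ⟨Gamma k lam X, by rintro _ ⟨g, -, h, rfl⟩; exact h X hX⟩ ⟨g, hg, hle, rfl⟩

theorem convGamma_le {d k : ℕ} {lam : ℝ} (h : 0 < lam) {X : Matrix (Fin d) (Fin d) ℝ}
    (hX : X.PosSemidef) : convGamma k lam X ≤ Gamma k lam X :=
  csSup_le ⟨0, fun _ => 0, convexOn_const 0 (convex_psdCone d), fun _ hY => Gamma_nonneg k h hY, rfl⟩
    (by rintro _ ⟨g, -, h, rfl⟩; exact h X hX)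

theorem convGamma_nonneg {d k : ℕ} {lam : ℝ} (h : 0 < lam) {X : Matrix (Fin d) (Fin d) ℝ}
    (hX : X.PosSemidef) : 0 ≤ convGamma k lam X :=
  le_convGamma hX (g := fun _ => 0) (convexOn_const 0 (convex_psdCone d))
    fun _ hY => Gamma_nonneg k h hY

theorem convexOn_const_sub_trace {d : ℕ} (c : ℝ) (W : Matrix (Fin d) (Fin d) ℝ) :
    ConvexOn ℝ (psdCone d) fun Y => c - (Y * W).trace := by
  refine ⟨convex_psdCone d, fun X _ Y _ s t _ _ hst => le_of_eq ?_⟩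
  simp only [Matrix.add_mul, Matrix.smul_mul, trace_add, trace_smul, smul_eq_mul]
  rw [← eq_sub_iff_add_eq'] at hst
  rw [hst]
  ring

theorem Gamma_eq_sum {d k : ℕ} (hk : k ≤ d) {lam : ℝ} {X : Matrix (Fin d) (Fin d) ℝ}
    {σ : Fin d → ℝ} (hG : ∀ k lam, Gamma k lam X
        = ∑ i : Fin (min k d), 1 / (σ (Fin.castLE (min_le_right k d) i) + lam)) :
    Gamma k lam X = ∑ i : Fin k, 1 / (σ (Fin.castLE hk i) + lam) := by
  rw [hG]
  exact Fintype.sum_equiv (finCongr (min_eq_left hk)) _ _ fun i => rfl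

theorem trace_sum_smul_mul {n d : ℕ} (a : Fin n → Fin d → ℝ) (x : Fin n → ℝ)
    (W : Matrix (Fin d) (Fin d) ℝ) :
    ((∑ i, x i • vecMulVec (a i) (a i)) * W).trace = ∑ i, x i * (a i ⬝ᵥ W *ᵥ a i) := by
  rw [trace_mul_comm, Finset.mul_sum, trace_sum]
  exact sum_congr rfl fun i _ => by
    rw [Matrix.mul_smul, trace_smul, trace_mul_vecMulVec, smul_eq_mul]

theorem posSemidef_conj_diagonal {d : ℕ} (V : Matrix (Fin d) (Fin d) ℝ) {γ : Fin d → ℝ}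
    (hγ : ∀ i, 0 ≤ γ i) : (V * diagonal γ * Vᵀ).PosSemidef := by
  simpa using (PosSemidef.diagonal hγ).mul_mul_conjTranspose_same V

/-! ### Lower bound for the envelope when k ≤ d -/

/-- Spectral data of the lifted Gram matrix with the supergradient weights in increasing order. -/
theorem exists_sorted_weights {n d m : ℕ} (hdn : d ≤ n) (hmd : m + 1 ≤ d)
    (a : Fin n → Fin d → ℝ) {lam : ℝ} (h : 0 < lam) {y : Fin n → ℝ} (hy : ∀ i, 0 ≤ y i)
    (hy1 : ∀ i, y i ≤ 1) (hsum : ((m + 1 : ℕ) : ℝ) ≤ ∑ i, y i)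
    {V : Matrix (Fin d) (Fin d) ℝ} {σ : Fin d → ℝ} (hV : V * Vᵀ = 1) (hσ : Antitone σ)
    (hσ0 : ∀ j, 0 ≤ σ j) (hX : ∑ i, y i • vecMulVec (a i) (a i) = V * diagonal σ * Vᵀ) :
    ∃ γ : Fin n → ℝ, Monotone γ ∧ (∀ i, 0 ≤ γ i) ∧
      ∑ j, γ (Fin.castLE hdn j) * σ j
          + lam * ∑ i : Fin (m + 1), γ (Fin.castLE (hmd.trans hdn) i)
        ≤ lam * weightSum a lam y (m + 1) / weightSum a lam y m ∧
      ∀ t : Fin (m + 1) → ℝ, (∀ i, 0 < t i) →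
        (∑ i, 1 / t i)⁻¹ ≤ ∑ i, γ (Fin.castLE (hmd.trans hdn) i) * t i := by
  set hkn := hmd.trans hdn
  obtain ⟨U, κ, hU1, hU2, -, hκ0, hK, -⟩ := exists_spectral (liftedGram_posSemidef a h hy)
  have hm0 : (m : ℝ) ≤ ∑ i, y i := le_trans (by push_cast; linarith) hsum
  have hw := weightSum_pos a h hy hy1 hm0
  have he := pow_mul_esym_eq a h hy hU1 hK (show m ≤ n by omega)
  have he' := pow_mul_esym_eq a h hy hU1 hK hkn
  have hem : 0 < esym κ m univ :=
    pos_of_mul_pos_right (he ▸ mul_pos (pow_pos h m) hw) (pow_pos h d).le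
  obtain ⟨γ, hγ0, hγκ, hγt⟩ := exists_supergradient κ m univ (fun i _ => hκ0 i) hem
  have hq : esym κ (m + 1) univ / esym κ m univ
      = lam * weightSum a lam y (m + 1) / weightSum a lam y m := by
    rw [div_eq_div_iff hem.ne' hw.ne']
    refine mul_left_cancel₀ (mul_pos (pow_pos h d) (pow_pos h m)).ne' ?_
    calc _ = (lam ^ d * esym κ (m + 1) univ) * (lam ^ m * weightSum a lam y m) := by ring
      _ = _ := by rw [he', ← he]; ring
  set π := Tuple.sort γ
  have hinj : Function.Injective (Fin.castLE hkn) := Fin.castLE_injective hkn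
  refine ⟨γ ∘ π, Tuple.monotone_sort γ, fun i => hγ0 _, ?_, ?_⟩
  · rw [← hq]
    refine le_trans ?_ hγκ
    set C := scaledCols a y with hC
    set P := U.submatrix id π with hP
    have hP1 : Pᵀ * P = 1 := by
      rw [hP, transpose_submatrix, ← submatrix_mul _ _ π id π Function.bijective_id, hU1,
        submatrix_one_equiv]
    have hP2 : P * Pᵀ = 1 := mul_eq_one_comm.1 hP1
    -- E is C in the eigenbases of CCᵀ and of the lifted Gram matrix: EEᵀ = diag σ, while EᵀE has
    -- the same diagonal as the C-part of that Gram matrix in its eigenbasis.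
    set E := Vᵀ * C * P with hE
    have hV' : Vᵀ * V = 1 := mul_eq_one_comm.1 hV
    have hEE : E * Eᵀ = diagonal σ := by
      calc E * Eᵀ = Vᵀ * (C * (P * Pᵀ) * Cᵀ) * V := by
            simp only [hE, transpose_mul, transpose_transpose, Matrix.mul_assoc]
        _ = (Vᵀ * V) * diagonal σ * (Vᵀ * V) := by
            rw [hP2, Matrix.mul_one, hC, scaledCols_mul_transpose a hy, hX]
            simp only [Matrix.mul_assoc]
        _ = _ := by rw [hV', Matrix.one_mul, Matrix.mul_one]
    have hET : Eᵀ * E = Pᵀ * (Cᵀ * C) * P := by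
      calc Eᵀ * E = Pᵀ * (Cᵀ * (V * Vᵀ) * C) * P := by
            simp only [hE, transpose_mul, transpose_transpose, Matrix.mul_assoc]
        _ = _ := by rw [hV, Matrix.mul_one]
    -- The diagonal of `diagonal y` in the eigenbasis: entries in [0, 1] with total ∑ y_i ≥ m + 1,
    -- hence a fractional selection costing at least the m + 1 smallest weights.
    set c : Fin n → ℝ := fun i => ∑ j, y j * P j i ^ 2 with hc
    have hκ : ∀ i, κ (π i) = ∑ j, E j i ^ 2 + lam * c i := by
      intro i
      have h1 : Pᵀ * liftedGram a lam y * P = (diagonal κ).submatrix π π := by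
        have : Uᵀ * liftedGram a lam y * U = diagonal κ := by
          calc _ = (Uᵀ * U) * diagonal κ * (Uᵀ * U) := by
                rw [hK]; simp only [Matrix.mul_assoc]
            _ = _ := by rw [hU1, Matrix.one_mul, Matrix.mul_one]
        rw [← this]
        rfl
      have h2 : Pᵀ * liftedGram a lam y * P = Eᵀ * E + lam • (Pᵀ * diagonal y * P) := by
        rw [hET, liftedGram, Matrix.mul_add, Matrix.add_mul, Matrix.mul_smul, Matrix.smul_mul]
      rw [h2] at h1
      have h3 := congrFun (congrFun h1 i) i
      simp only [Matrix.add_apply, Matrix.smul_apply, submatrix_apply, diagonal_apply_eq, smul_eq_mul,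
        mul_apply (M := Eᵀ), mul_apply (M := Pᵀ * diagonal y), mul_diagonal, transpose_apply] at h3
      rw [← h3, hc]
      congr 1
      · exact sum_congr rfl fun j _ => (sq _).symm
      · congr 1
        exact sum_congr rfl fun j _ => by ring
    have hcol : ∀ i, ∑ j, P j i ^ 2 = 1 := fun i => by
      simpa [mul_apply, sq] using congrFun (congrFun hP1 i) i
    have hrow : ∀ j, ∑ i, P j i ^ 2 = 1 := fun j => by
      simpa [mul_apply, sq] using congrFun (congrFun hP2 j) j
    have hs : ∑ i : Fin (m + 1), (γ ∘ π) (Fin.castLE hkn i) ≤ ∑ i, (γ ∘ π) i * c i := by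
      have := sum_le_sum_mul_of_smallest (γ := γ ∘ π) (c := c)
        (J := univ.image (Fin.castLE hkn)) ?_ (fun i => hγ0 _)
        (fun i => sum_nonneg fun j _ => mul_nonneg (hy j) (sq_nonneg _))
        (fun i => ?_) ?_
      · rwa [sum_image fun x _ y _ h => hinj h] at this
      · intro i hi l hl
        obtain ⟨j, -, rfl⟩ := mem_image.1 hi
        apply Tuple.monotone_sort γ
        by_contra hlt
        push Not at hlt
        have hlt' : l.1 < j.1 := hlt
        exact hl (mem_image.2 ⟨⟨l.1, by omega⟩, mem_univ _, rfl⟩)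
      · rw [← hcol i]
        exact sum_le_sum fun j _ => mul_le_of_le_one_left (sq_nonneg _) (hy1 j)
      · rw [card_image_of_injective _ hinj, card_univ, Fintype.card_fin, hc, sum_comm]
        simpa only [← mul_sum, hrow, mul_one] using hsum
    have ht := sum_mul_le_sum_sq hdn hEE (Tuple.monotone_sort γ) (fun i => hγ0 (π i)) hσ hσ0
    calc _ ≤ ∑ i, (γ ∘ π) i * ∑ j, E j i ^ 2 + lam * ∑ i, (γ ∘ π) i * c i :=
          add_le_add ht (mul_le_mul_of_nonneg_left hs h.le)
      _ = ∑ i, γ (π i) * κ (π i) := by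
          rw [mul_sum, ← sum_add_distrib]
          refine sum_congr rfl fun i _ => ?_
          rw [hκ, Function.comp]
          ring
      _ = _ := Equiv.sum_comp π fun i => γ i * κ i
  · intro t ht
    set φ : Fin (m + 1) → Fin n := fun i => π (Fin.castLE hkn i) with hφ
    have hφi : Function.Injective φ := π.injective.comp hinj
    have := hγt (univ.image φ) (subset_univ _)
      (by rw [card_image_of_injective _ hφi, card_univ, Fintype.card_fin])
      (Function.extend φ t 1) ?_
    · rw [sum_image fun x _ y _ h => hφi h, sum_image fun x _ y _ h => hφi h] at this
      simp only [hφi.extend_apply] at this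
      exact this
    · intro i hi
      obtain ⟨j, -, rfl⟩ := mem_image.1 hi
      rw [hφi.extend_apply]
      exact ht j

/-- Lower bound for the convex envelope by the ratio of consecutive weight sums. -/
theorem weightSum_div_le_convGamma {n d m : ℕ} (hdn : d ≤ n) (hmd : m + 1 ≤ d)
    (a : Fin n → Fin d → ℝ) {lam : ℝ} (h : 0 < lam) {x y : Fin n → ℝ} (hx : ∀ i, 0 ≤ x i)
    (hxy : ∀ i, x i ≤ y i) (hy1 : ∀ i, y i ≤ 1) (hsum : ((m + 1 : ℕ) : ℝ) ≤ ∑ i, y i) :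
    weightSum a lam y m / (lam * weightSum a lam y (m + 1))
      ≤ convGamma (m + 1) lam (∑ i, x i • vecMulVec (a i) (a i)) := by
  have hy : ∀ i, 0 ≤ y i := fun i => (hx i).trans (hxy i)
  obtain ⟨V, σ, hV1, hV2, hσ, hσ0, hXy, -⟩ := exists_spectral (posSemidef_sum_smul a hy)
  obtain ⟨γ, hγ, hγ0, hγσ, hγt⟩ :=
    exists_sorted_weights hdn hmd a h hy hy1 hsum hV2 hσ hσ0 hXy
  have hm0 : (m : ℝ) ≤ ∑ i, y i := le_trans (by push_cast; linarith) hsum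
  have hw := weightSum_pos a h hy hy1 hm0
  have hw' := weightSum_pos a h hy hy1 hsum
  set ρ := weightSum a lam y m / (lam * weightSum a lam y (m + 1)) with hρ
  have hρ0 : 0 < ρ := div_pos hw (mul_pos h hw')
  have hρi : lam * weightSum a lam y (m + 1) / weightSum a lam y m = ρ⁻¹ := by
    rw [hρ, inv_div]
  rw [hρi] at hγσ
  set γ' : Fin d → ℝ := fun j => γ (Fin.castLE hdn j) with hγ'
  have hγ'm : Monotone γ' := fun i j hij => hγ hij
  set s := ∑ i : Fin (m + 1), γ (Fin.castLE (hmd.trans hdn) i) with hs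
  set W := V * diagonal γ' * Vᵀ with hW
  have hWpsd : W.PosSemidef := posSemidef_conj_diagonal V fun j => hγ0 _
  -- The minorant comes from G ≥ 2ρ − ρ²/G, the tangent at 1/ρ of the convex map u ↦ 1/u, with
  -- 1/Γ(Y) majorized by tr(YW) + λs. At X that majorant is at most 1/ρ, so the value is at least ρ.
  have hmain := le_convGamma (k := m + 1) (lam := lam) (posSemidef_sum_smul a hx)
    (convexOn_const_sub_trace (2 * ρ - ρ ^ 2 * (lam * s)) (ρ ^ 2 • W)) ?_
  · refine le_trans ?_ hmain
    have h1 : ((∑ i, x i • vecMulVec (a i) (a i)) * W).trace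
        ≤ ((∑ i, y i • vecMulVec (a i) (a i)) * W).trace := by
      rw [trace_sum_smul_mul, trace_sum_smul_mul]
      refine sum_le_sum fun i _ => mul_le_mul_of_nonneg_right (hxy i) ?_
      simpa using hWpsd.dotProduct_mulVec_nonneg (a i)
    have h2 : ((∑ i, y i • vecMulVec (a i) (a i)) * W).trace = ∑ j, γ' j * σ j := by
      rw [hXy, hW, trace_mul_conj_diagonal, hV1]
      simp [one_apply]
    rw [h2] at h1
    rw [Matrix.mul_smul, trace_smul, smul_eq_mul]
    have h3 := mul_le_mul_of_nonneg_left (add_le_add_left h1 (lam * s)) (sq_nonneg ρ)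
    have h4 := mul_le_mul_of_nonneg_left hγσ (sq_nonneg ρ)
    have h5 : ρ ^ 2 * ρ⁻¹ = ρ := by field_simp
    nlinarith
  · intro Y hY
    obtain ⟨U, τ, hU1, hU2, hτ, hτ0, hYU, hG⟩ := exists_spectral hY
    rw [Gamma_eq_sum hmd hG]
    have h1 : ∑ j, γ' j * τ j ≤ (Y * W).trace := by
      rw [hYU]
      exact sum_mul_le_trace hV2 hU2 hγ'm (fun j => hγ0 _) hτ hτ0
    have h2 : ∑ i : Fin (m + 1), γ (Fin.castLE (hmd.trans hdn) i) * τ (Fin.castLE hmd i)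
        ≤ ∑ j, γ' j * τ j := by
      have hinj : Function.Injective (Fin.castLE hmd) := Fin.castLE_injective hmd
      have e : ∑ i : Fin (m + 1), γ (Fin.castLE (hmd.trans hdn) i) * τ (Fin.castLE hmd i)
          = ∑ j ∈ univ.image (Fin.castLE hmd), γ' j * τ j := by
        rw [sum_image fun x _ y _ h => hinj h]
        rfl
      rw [e]
      exact sum_le_sum_of_subset_of_nonneg (subset_univ _)
        fun j _ _ => mul_nonneg (hγ0 _) (hτ0 j)
    have htp : ∀ i : Fin (m + 1), 0 < τ (Fin.castLE hmd i) + lam :=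
      fun i => add_pos_of_nonneg_of_pos (hτ0 _) h
    have h3 := hγt (fun i => τ (Fin.castLE hmd i) + lam) htp
    simp only [mul_add, sum_add_distrib, ← sum_mul] at h3
    set G := ∑ i : Fin (m + 1), 1 / (τ (Fin.castLE hmd i) + lam) with hGdef
    have hG0 : 0 < G := sum_pos (fun i _ => one_div_pos.2 (htp i)) univ_nonempty
    rw [Matrix.mul_smul, trace_smul, smul_eq_mul]
    have h4 : ρ ^ 2 * G⁻¹ ≤ ρ ^ 2 * ((Y * W).trace + lam * s) :=
      mul_le_mul_of_nonneg_left (by linarith) (sq_nonneg ρ)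
    have h5 : 2 * ρ - ρ ^ 2 * G⁻¹ ≤ G := by
      have : G - (2 * ρ - ρ ^ 2 * G⁻¹) = (G - ρ) ^ 2 / G := by
        field_simp
        ring
      have h6 : 0 ≤ (G - ρ) ^ 2 / G := by positivity
      linarith
    linarith

/-! ### Comparing the optimum with the relaxation -/

theorem optVal_le {n d : ℕ} (a : Fin n → Fin d → ℝ) {lam : ℝ} (h : 0 < lam) {k : ℕ}
    {S : Finset (Fin n)} (hS : S.card = k) : optVal a lam k ≤ objective a lam S :=
  csInf_le ⟨0, by
    rintro _ ⟨T, -, rfl⟩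
    exact (regInfo_posDef a h T).inv.posSemidef.trace_nonneg⟩ ⟨S, hS, rfl⟩

theorem exists_optVal_eq {n d k : ℕ} (hkn : k ≤ n) (a : Fin n → Fin d → ℝ) (lam : ℝ) :
    ∃ S : Finset (Fin n), S.card = k ∧ objective a lam S = optVal a lam k := by
  obtain ⟨S, -, hS⟩ := exists_subset_card_eq (s := (univ : Finset (Fin n))) (n := k) (by simpa)
  have hfin : {t : ℝ | ∃ S : Finset (Fin n), S.card = k ∧ objective a lam S = t}.Finite :=
    (Set.finite_range (objective a lam)).subset fun _ ⟨S, _, hS⟩ => ⟨S, hS⟩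
  have hne : {t : ℝ | ∃ S : Finset (Fin n), S.card = k ∧ objective a lam S = t}.Nonempty :=
    ⟨_, S, hS, rfl⟩
  exact hne.csInf_mem hfin

theorem trace_inv_eq_sum {d : ℕ} {X U : Matrix (Fin d) (Fin d) ℝ} {σ : Fin d → ℝ}
    (hU : Uᵀ * U = 1) (hσ : ∀ j, 0 ≤ σ j) (hX : X = U * diagonal σ * Uᵀ) {lam : ℝ} (h : 0 < lam) :
    ((X + lam • (1 : Matrix (Fin d) (Fin d) ℝ))⁻¹).trace = ∑ j, 1 / (σ j + lam) := by
  have hU' : U * Uᵀ = 1 := mul_eq_one_comm.1 hU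
  have h1 : X + lam • (1 : Matrix (Fin d) (Fin d) ℝ) = U * diagonal (fun j => σ j + lam) * Uᵀ := by
    have : diagonal (fun j => σ j + lam) = diagonal σ + lam • (1 : Matrix (Fin d) (Fin d) ℝ) := by
      rw [smul_one_eq_diagonal, diagonal_add]
    rw [this, Matrix.mul_add, Matrix.add_mul, ← hX, Matrix.mul_smul, Matrix.smul_mul,
      Matrix.mul_one, hU']
  have h2 : (X + lam • (1 : Matrix (Fin d) (Fin d) ℝ))⁻¹
      = U * diagonal (fun j => 1 / (σ j + lam)) * Uᵀ := by
    refine inv_eq_right_inv ?_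
    calc _ = U * (diagonal (fun j => σ j + lam) * (Uᵀ * U)
          * diagonal (fun j => 1 / (σ j + lam))) * Uᵀ := by
          rw [h1]; simp only [Matrix.mul_assoc]
      _ = U * Uᵀ := by
          rw [hU, Matrix.mul_one, diagonal_mul_diagonal]
          have : (fun j => (σ j + lam) * (1 / (σ j + lam))) = fun _ => (1 : ℝ) :=
            funext fun j => mul_one_div_cancel (add_pos_of_nonneg_of_pos (hσ j) h).ne'
          rw [this, diagonal_one, Matrix.mul_one]
      _ = 1 := hU'
  rw [h2, trace_mul_comm, ← Matrix.mul_assoc, hU, Matrix.one_mul, trace_diagonal]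

/-- Eigenvalues, in decreasing order, vanish beyond the rank. -/
theorem eigenvalue_eq_zero_of_rank_le {d k : ℕ} {X U : Matrix (Fin d) (Fin d) ℝ} {σ : Fin d → ℝ}
    (hU : Uᵀ * U = 1) (hσ : Antitone σ) (hσ0 : ∀ j, 0 ≤ σ j) (hX : X = U * diagonal σ * Uᵀ)
    (hr : X.rank ≤ k) {j : Fin d} (hj : k ≤ j) : σ j = 0 := by
  by_contra hne
  have h1 : (diagonal σ).rank ≤ k := by
    have : diagonal σ = Uᵀ * X * U := by
      calc _ = (Uᵀ * U) * diagonal σ * (Uᵀ * U) := by rw [hU, Matrix.one_mul, Matrix.mul_one]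
        _ = _ := by rw [hX]; simp only [Matrix.mul_assoc]
    rw [this]
    exact (rank_mul_le_left _ _).trans ((rank_mul_le_right _ _).trans hr)
  rw [rank_diagonal, Fintype.card_subtype] at h1
  have h2 : (Finset.Iic j) ⊆ univ.filter fun i => σ i ≠ 0 := by
    intro i hi
    refine mem_filter.2 ⟨mem_univ _, fun h => hne (le_antisymm ?_ (hσ0 j))⟩
    exact h ▸ hσ (mem_Iic.1 hi)
  have h3 := card_le_card h2
  rw [Fin.card_Iic] at h3
  omega

theorem rank_sum_vecMulVec_le {n d : ℕ} (a : Fin n → Fin d → ℝ) (S : Finset (Fin n)) :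
    (∑ i ∈ S, vecMulVec (a i) (a i)).rank ≤ S.card := by
  set B : Matrix (Fin d) S ℝ := of fun r i => a i r with hB
  have h2 : ∑ i ∈ S, vecMulVec (a i) (a i) = B * Bᵀ := by
    rw [← sum_coe_sort S fun i => vecMulVec (a i) (a i)]
    ext r s
    simp [hB, mul_apply, Matrix.sum_apply, vecMulVec_apply]
  rw [h2]
  exact (rank_mul_le_left _ _).trans ((rank_le_card_width B).trans (by simp))

theorem Gamma_add_eq_objective {n d k : ℕ} (a : Fin n → Fin d → ℝ) {lam : ℝ} (h : 0 < lam)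
    {S : Finset (Fin n)} (hS : S.card = k) :
    Gamma k lam (∑ i ∈ S, vecMulVec (a i) (a i)) + ((d : ℝ) - ((min k d : ℕ) : ℝ)) / lam
      = objective a lam S := by
  have hpsd : (∑ i ∈ S, vecMulVec (a i) (a i)).PosSemidef :=
    posSemidef_sum _ fun i _ => posSemidef_vecMulVec_self (a i)
  obtain ⟨U, σ, hU1, -, hσ, hσ0, hX, hG⟩ := exists_spectral hpsd
  rw [hG, objective, trace_inv_eq_sum hU1 hσ0 hX h]
  have hinj : Function.Injective (Fin.castLE (min_le_right k d)) := Fin.castLE_injective _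
  set J := univ.image (Fin.castLE (min_le_right k d)) with hJ
  have hJc : J.card = min k d := by
    rw [hJ, card_image_of_injective _ hinj, card_univ, Fintype.card_fin]
  rw [← sum_add_sum_compl J, hJ, sum_image fun x _ y _ h => hinj h, ← hJ]
  congr 1
  have hz : ∀ j ∈ Jᶜ, 1 / (σ j + lam) = 1 / lam := by
    intro j hj
    have hjk : k ≤ j := by
      by_contra hlt
      push Not at hlt
      refine mem_compl.1 hj (mem_image.2 ⟨⟨j.1, lt_min hlt j.2⟩, mem_univ _, rfl⟩)
    rw [eigenvalue_eq_zero_of_rank_le hU1 hσ hσ0 hX (hS ▸ rank_sum_vecMulVec_le a S) hjk, zero_add]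
  rw [sum_congr rfl hz, sum_const, card_compl, hJc, Fintype.card_fin, nsmul_eq_mul,
    Nat.cast_sub (min_le_right k d)]
  ring

theorem relaxedObjective_nonneg {n d k : ℕ} (a : Fin n → Fin d → ℝ) {lam : ℝ} (h : 0 < lam)
    {x : Fin n → ℝ} (hx : x ∈ relaxedDomain n k) : 0 ≤ relaxedObjective a lam k x := by
  refine add_nonneg (convGamma_nonneg h (posSemidef_sum_smul a fun i => (hx.1 i).1))
    (div_nonneg (sub_nonneg.2 ?_) h.le)
  exact_mod_cast min_le_right k d

theorem indicator_mem_relaxedDomain {n k : ℕ} {S : Finset (Fin n)} (hS : S.card = k) :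
    (fun i => if i ∈ S then (1 : ℝ) else 0) ∈ relaxedDomain n k := by
  refine ⟨fun i => ?_, ?_⟩
  · dsimp only
    split_ifs <;> simp
  · simp [hS]

theorem relaxedVal_le_optVal {n d k : ℕ} (hkn : k ≤ n) (a : Fin n → Fin d → ℝ) {lam : ℝ}
    (h : 0 < lam) : relaxedVal a lam k ≤ optVal a lam k := by
  obtain ⟨S, hS, hopt⟩ := exists_optVal_eq hkn a lam
  have hle : relaxedVal a lam k
      ≤ relaxedObjective a lam k fun i => if i ∈ S then (1 : ℝ) else 0 := by
    refine csInf_le ⟨0, ?_⟩ ⟨_, indicator_mem_relaxedDomain hS, rfl⟩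
    rintro _ ⟨x, hx, rfl⟩
    exact relaxedObjective_nonneg a h hx
  refine hle.trans ?_
  rw [← hopt, ← Gamma_add_eq_objective a h hS, relaxedObjective]
  simp only [ite_smul, one_smul, zero_smul, sum_ite_mem, univ_inter]
  exact add_le_add_left
    (convGamma_le h (posSemidef_sum _ fun i _ => posSemidef_vecMulVec_self (a i))) _

/-- The pointwise bound passes to the infimum and also makes `relaxedVal` positive, so the quotient
is meaningful. -/
theorem ratio_bounds {n d k : ℕ} (hd : 1 ≤ d) (hkn : k ≤ n) (a : Fin n → Fin d → ℝ) {lam : ℝ}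
    (h : 0 < lam) {c : ℝ} (hc : 0 < c)
    (hle : ∀ x ∈ relaxedDomain n k, optVal a lam k ≤ c * relaxedObjective a lam k x) :
    1 ≤ optVal a lam k / relaxedVal a lam k ∧ optVal a lam k / relaxedVal a lam k ≤ c := by
  obtain ⟨S, hS, hopt⟩ := exists_optVal_eq hkn a lam
  have hz : 0 < optVal a lam k := hopt ▸ objective_pos hd a h S
  have h1 : optVal a lam k / c ≤ relaxedVal a lam k := by
    refine le_csInf ⟨_, _, indicator_mem_relaxedDomain hS, rfl⟩ ?_
    rintro _ ⟨x, hx, rfl⟩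
    rw [div_le_iff₀' hc]
    exact hle x hx
  have hν : 0 < relaxedVal a lam k := (div_pos hz hc).trans_le h1
  refine ⟨(one_le_div hν).2 (relaxedVal_le_optVal hkn a h), ?_⟩
  rw [div_le_iff₀ hν]
  rwa [div_le_iff₀' hc] at h1

/-! ### Rounding by sampling when k ≤ d -/

/-- Rounding bound for `k = m + 1 ≤ d`, by sampling a `k`-set with weights
`∏ y_i det (∑ a_i a_iᵀ + lam I)`. -/
theorem optVal_sub_le {n d m : ℕ} (hdn : d ≤ n) (hmd : m + 1 ≤ d)
    (a : Fin n → Fin d → ℝ) {lam : ℝ} (h : 0 < lam) {x y : Fin n → ℝ} (hx : ∀ i, 0 ≤ x i)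
    (hxy : ∀ i, x i ≤ y i) (hy1 : ∀ i, y i ≤ 1) (hsum : ((m + 1 : ℕ) : ℝ) ≤ ∑ i, y i) {c : ℝ}
    (hc0 : 0 ≤ c) (hc : ∀ T : Finset (Fin n), T.card = m → ∑ i ∈ univ \ T, y i ≤ c) :
    optVal a lam (m + 1) - (d - (m + 1)) / lam
      ≤ c * convGamma (m + 1) lam (∑ i, x i • vecMulVec (a i) (a i)) := by
  have hy : ∀ i, 0 ≤ y i := fun i => (hx i).trans (hxy i)
  have hw' := weightSum_pos a h hy hy1 hsum
  refine le_trans ?_ (mul_le_mul_of_nonneg_left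
    (weightSum_div_le_convGamma hdn hmd a h hx hxy hy1 hsum) hc0)
  rw [← mul_div_assoc, le_div_iff₀ (mul_pos h hw')]
  have hav := sum_weights_mul_objective a h y m
  have hnn : ∀ T : Finset (Fin n), 0 ≤ (∏ i ∈ T, y i) * (regInfo a lam T).det :=
    fun T => mul_nonneg (prod_nonneg fun i _ => hy i) (det_regInfo_pos a h T).le
  calc _ = lam * ∑ S ∈ (univ : Finset (Fin n)).powersetCard (m + 1),
        (∏ i ∈ S, y i) * (regInfo a lam S).det
          * (optVal a lam (m + 1) - (d - (m + 1)) / lam) := by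
        rw [← sum_mul, weightSum]
        ring
    _ ≤ _ := by
        refine mul_le_mul_of_nonneg_left (sum_le_sum fun S hS => ?_) h.le
        exact mul_le_mul_of_nonneg_left
          (sub_le_sub_right (optVal_le a h (mem_powersetCard.1 hS).2) _) (hnn S)
    _ = _ := hav
    _ ≤ ∑ T ∈ (univ : Finset (Fin n)).powersetCard m,
        (∏ i ∈ T, y i) * (regInfo a lam T).det * c :=
        sum_le_sum fun T hT =>
          mul_le_mul_of_nonneg_left (hc T (mem_powersetCard.1 hT).2) (hnn T)
    _ = _ := by rw [← sum_mul, weightSum, mul_comm]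

theorem optVal_sub_le_of_mem {n d k : ℕ} (hk : 1 ≤ k) (hdn : d ≤ n) (hkd : k ≤ d)
    (a : Fin n → Fin d → ℝ) {lam : ℝ} (h : 0 < lam) {x : Fin n → ℝ}
    (hx : x ∈ relaxedDomain n k) :
    optVal a lam k - (d - k) / lam
        ≤ k * convGamma k lam (∑ i, x i • vecMulVec (a i) (a i)) ∧
      optVal a lam k - (d - k) / lam
        ≤ (n - k + 1) * convGamma k lam (∑ i, x i • vecMulVec (a i) (a i)) := by
  obtain ⟨m, rfl⟩ : ∃ m, k = m + 1 := ⟨k - 1, by omega⟩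
  have hx0 := fun i => (hx.1 i).1
  have hx1 := fun i => (hx.1 i).2
  have hmn : ((m + 1 : ℕ) : ℝ) ≤ n := by exact_mod_cast hkd.trans hdn
  push_cast at hmn ⊢
  constructor
  · refine optVal_sub_le hdn hkd a h hx0 (fun i => le_rfl) hx1 hx.2.ge (by positivity) ?_
    intro T _
    refine (sum_le_sum_of_subset_of_nonneg (subset_univ _) fun i _ _ => hx0 i).trans ?_
    rw [hx.2]
    push_cast
    exact le_rfl
  -- With y = 1 the mass outside an m-set is exactly n − m = n − k + 1.
  · refine optVal_sub_le (y := fun _ => 1) hdn hkd a h hx0 hx1 (fun i => le_rfl) ?_ (by linarith) ?_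
    · simpa using hmn
    · intro T hT
      rw [sum_const, card_univ_sdiff, hT, Fintype.card_fin, nsmul_eq_mul, Nat.cast_sub (by omega)]
      linarith

/-! ### The case k > d: the full ground set and greedy deletion -/

/-- For `k ≥ d` the convex envelope dominates the objective at the full ground set. -/
theorem trace_inv_le_convGamma {n d k : ℕ} (hdk : d ≤ k) (a : Fin n → Fin d → ℝ) {lam : ℝ}
    (h : 0 < lam) {x : Fin n → ℝ} (hx : ∀ i, 0 ≤ x i) (hx1 : ∀ i, x i ≤ 1) :
    objective a lam univ ≤ convGamma k lam (∑ i, x i • vecMulVec (a i) (a i)) := by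
  rw [objective_eq]
  set R := (regInfo a lam univ)⁻¹ with hR
  have hRpd : R.PosDef := (regInfo_posDef a h univ).inv
  have hRt : Rᵀ = R := by simpa using hRpd.isHermitian.eq
  have hRR : (R * R).PosSemidef := by
    have := posSemidef_conjTranspose_mul_self R
    rwa [conjTranspose_eq_transpose_of_trivial, hRt] at this
  -- This is the tangent plane of Y ↦ tr((Y + λI)⁻¹) at the full information matrix, whose
  -- regularized inverse is R.
  refine le_trans ?_ (le_convGamma (posSemidef_sum_smul a hx)
    (convexOn_const_sub_trace (2 * R.trace - lam * (R * R).trace) (R * R)) ?_)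
  · have h1 : ((∑ i, x i • vecMulVec (a i) (a i)) * (R * R)).trace
        ≤ ((∑ i, vecMulVec (a i) (a i)) * (R * R)).trace := by
      have := trace_sum_smul_mul a (fun _ => 1) (R * R)
      simp only [one_smul, one_mul] at this
      rw [trace_sum_smul_mul, this]
      refine sum_le_sum fun i _ => mul_le_of_le_one_left ?_ (hx1 i)
      simpa using hRR.dotProduct_mulVec_nonneg (a i)
    have h2 : ((∑ i, vecMulVec (a i) (a i)) * (R * R)).trace + lam * (R * R).trace = R.trace := by
      have hB := (isUnit_iff_isUnit_det _).1 (regInfo_posDef a h univ).isUnit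
      have h3 : (regInfo a lam univ * (R * R)).trace = R.trace := by
        rw [← Matrix.mul_assoc, hR, mul_nonsing_inv _ hB, Matrix.one_mul]
      rw [regInfo, Matrix.add_mul, trace_add, Matrix.smul_mul, Matrix.one_mul, trace_smul,
        smul_eq_mul] at h3
      exact h3
    linarith
  · intro Y hY
    obtain ⟨U, τ, hU1, hU2, -, hτ0, hYU, hG⟩ := exists_spectral hY
    have hGs : Gamma k lam Y = ∑ j, 1 / (τ j + lam) := by
      rw [hG]
      exact Fintype.sum_equiv (finCongr (min_eq_right hdk)) _ _ fun i => rfl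
    set Q := Uᵀ * R * U with hQ
    have hQt : Qᵀ = Q := by
      rw [hQ, transpose_mul, transpose_mul, transpose_transpose, hRt, Matrix.mul_assoc]
    have hQQ : Q * Q = Uᵀ * (R * R) * U := by
      calc Q * Q = Uᵀ * (R * (U * Uᵀ) * R) * U := by simp only [hQ, Matrix.mul_assoc]
        _ = _ := by rw [hU2, Matrix.mul_one]
    have t1 : R.trace = ∑ j, Q j j := by
      have : Q.trace = R.trace := by rw [hQ, trace_mul_comm, ← Matrix.mul_assoc, hU2, Matrix.one_mul]
      exact this.symm
    have t2 : (R * R).trace = ∑ j, (Q * Q) j j := by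
      have : (Q * Q).trace = (R * R).trace := by
        rw [hQQ, trace_mul_comm, ← Matrix.mul_assoc, hU2, Matrix.one_mul]
      exact this.symm
    have t3 : (Y * (R * R)).trace = ∑ j, τ j * (Q * Q) j j := by
      have : (Y * (R * R)).trace = (diagonal τ * (Q * Q)).trace := by
        rw [hQQ, hYU, ← Matrix.mul_assoc, ← Matrix.mul_assoc, trace_mul_comm _ U]
        simp only [Matrix.mul_assoc]
      rw [this, trace]
      simp only [diag_apply, diagonal_mul]
    rw [hGs, t1, t2, t3, mul_sum, mul_sum, ← sum_sub_distrib, ← sum_sub_distrib]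
    refine sum_le_sum fun j _ => ?_
    -- In the eigenbasis of Y, dropping the off-diagonal entries of Q reduces the claim to the
    -- scalar inequality 1/t ≥ 2q − tq².
    have hsq : Q j j ^ 2 ≤ (Q * Q) j j := by
      rw [mul_apply]
      have : ∀ l, Q j l * Q l j = Q j l ^ 2 := fun l => by
        rw [sq, ← congrFun (congrFun hQt l) j, transpose_apply]
      simp only [this]
      exact single_le_sum (f := fun l => Q j l ^ 2) (fun l _ => sq_nonneg _) (mem_univ j)
    have ht : 0 < τ j + lam := add_pos_of_nonneg_of_pos (hτ0 j) h
    have h1 : (τ j + lam) * Q j j ^ 2 ≤ (τ j + lam) * (Q * Q) j j :=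
      mul_le_mul_of_nonneg_left hsq ht.le
    have h2 : 1 / (τ j + lam) - 2 * Q j j + (τ j + lam) * Q j j ^ 2
        = ((τ j + lam) * Q j j - 1) ^ 2 / (τ j + lam) := by
      field_simp
      ring
    have h3 : 0 ≤ ((τ j + lam) * Q j j - 1) ^ 2 / (τ j + lam) := by positivity
    linarith

/-- The Sherman–Morrison formula for the objective. -/
theorem leverage_mul_objective_erase {n d : ℕ} (a : Fin n → Fin d → ℝ) {lam : ℝ} (h : 0 < lam)
    {S : Finset (Fin n)} {i : Fin n} (hi : i ∈ S) :
    (1 - a i ⬝ᵥ (regInfo a lam S)⁻¹ *ᵥ a i) * objective a lam (S.erase i)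
      = (1 - a i ⬝ᵥ (regInfo a lam S)⁻¹ *ᵥ a i) * objective a lam S
        + a i ⬝ᵥ ((regInfo a lam S)⁻¹ * (regInfo a lam S)⁻¹) *ᵥ a i := by
  have hlt := leverage_lt_one a h hi
  have hB := (isUnit_iff_isUnit_det _).1 (regInfo_posDef a h S).isUnit
  rw [objective_eq, objective_eq, regInfo_erase a lam hi]
  have hRt : ((regInfo a lam S)⁻¹)ᵀ = (regInfo a lam S)⁻¹ := by
    simpa using (regInfo_posDef a h S).inv.isHermitian.eq
  set B := regInfo a lam S
  set v := a i
  set u := B⁻¹ *ᵥ v with hu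
  have hvB : v ᵥ* B⁻¹ = u := by rw [hu, ← vecMul_transpose, hRt]
  have hne : 1 - v ⬝ᵥ u ≠ 0 := (sub_pos.2 hlt).ne'
  have hinv : (B - vecMulVec v v)⁻¹ = B⁻¹ + (1 - v ⬝ᵥ u)⁻¹ • vecMulVec u u := by
    refine inv_eq_right_inv ?_
    have hBu : B *ᵥ u = v := by rw [hu, mulVec_mulVec, mul_nonsing_inv _ hB, one_mulVec]
    rw [Matrix.sub_mul, Matrix.mul_add, Matrix.mul_add, mul_nonsing_inv _ hB, Matrix.mul_smul,
      Matrix.mul_smul, mul_vecMulVec, hBu, vecMulVec_mul, hvB, vecMulVec_mul_vecMulVec]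
    ext r s
    simp only [Matrix.sub_apply, Matrix.add_apply, Matrix.smul_apply, vecMulVec_apply, smul_eq_mul,
      Pi.smul_apply]
    field_simp
    ring
  have huu : v ⬝ᵥ (B⁻¹ * B⁻¹) *ᵥ v = u ⬝ᵥ u := by
    rw [← mulVec_mulVec, ← hu, dotProduct_mulVec, hvB]
  rw [hinv, trace_add, trace_smul, trace_vecMulVec, huu, smul_eq_mul, mul_add,
    mul_inv_cancel_left₀ hne]

/-- Average over i with weights w_i = 1 − leverage. By Sherman–Morrison the weighted sum of f(S∖i)
is at most (∑ w_i) f(S) + f(S), and ∑ w_i = m − d + 1 + λ f(S) ≥ m − d + 1, so some i attains the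
factor 1 + 1/(m − d + 1). -/
theorem exists_erase_objective_le {n d m : ℕ} (hdm : d ≤ m) (a : Fin n → Fin d → ℝ) {lam : ℝ}
    (h : 0 < lam) {S : Finset (Fin n)} (hS : S.card = m + 1) :
    ∃ i ∈ S, objective a lam (S.erase i) * ((m : ℝ) - d + 1)
      ≤ ((m : ℝ) - d + 2) * objective a lam S := by
  by_contra! hcon
  set B := regInfo a lam S
  set w : Fin n → ℝ := fun i => 1 - a i ⬝ᵥ B⁻¹ *ᵥ a i with hw
  set z := objective a lam S with hz
  have hdm' : (d : ℝ) ≤ m := by exact_mod_cast hdm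
  have hw0 : ∀ i ∈ S, 0 < w i := fun i hi => sub_pos.2 (leverage_lt_one a h hi)
  have hW : ∑ i ∈ S, w i = m - d + 1 + lam * z := by
    rw [hw, sum_sub_distrib, sum_leverage a h, sum_const, hS, nsmul_eq_mul]
    push_cast
    ring
  have hz0 : 0 ≤ z := (regInfo_posDef a h S).inv.posSemidef.trace_nonneg
  have hQ : ∑ i ∈ S, a i ⬝ᵥ (B⁻¹ * B⁻¹) *ᵥ a i ≤ z := by
    have hB := (isUnit_iff_isUnit_det _).1 (regInfo_posDef a h S).isUnit
    have h1 : (B⁻¹ * B⁻¹ * (∑ i ∈ S, vecMulVec (a i) (a i)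
        + lam • (1 : Matrix (Fin d) (Fin d) ℝ))).trace = z := by
      have : (B⁻¹ * B⁻¹ * B).trace = z := by
        rw [Matrix.mul_assoc, nonsing_inv_mul _ hB, Matrix.mul_one]
        rfl
      exact this
    rw [Matrix.mul_add, trace_add, Matrix.mul_smul, Matrix.mul_one, trace_smul, Finset.mul_sum,
      trace_sum] at h1
    simp only [trace_mul_vecMulVec] at h1
    have h2 : 0 ≤ (B⁻¹ * B⁻¹).trace := by
      have hRt : (B⁻¹)ᵀ = B⁻¹ := by
        simpa using (regInfo_posDef a h S).inv.isHermitian.eq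
      have := (posSemidef_conjTranspose_mul_self B⁻¹).trace_nonneg
      rwa [conjTranspose_eq_transpose_of_trivial, hRt] at this
    have h3 := mul_nonneg h.le h2
    rw [smul_eq_mul] at h1
    linarith
  have hne : S.Nonempty := card_pos.1 (by omega)
  have hlt := sum_lt_sum_of_nonempty hne fun i hi => mul_lt_mul_of_pos_left (hcon i hi) (hw0 i hi)
  have he : ∑ i ∈ S, w i * (objective a lam (S.erase i) * ((m : ℝ) - d + 1))
      = ((∑ i ∈ S, w i) * z + ∑ i ∈ S, a i ⬝ᵥ (B⁻¹ * B⁻¹) *ᵥ a i) * ((m : ℝ) - d + 1) := by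
    rw [sum_mul, ← sum_add_distrib, sum_mul]
    refine sum_congr rfl fun i hi => ?_
    rw [← mul_assoc, leverage_mul_objective_erase a h hi]
  rw [he, ← sum_mul, hW] at hlt
  have h4 := mul_le_mul_of_nonneg_right hQ (by linarith : (0 : ℝ) ≤ (m : ℝ) - d + 1)
  have h5 := mul_nonneg (mul_nonneg h.le hz0) hz0
  nlinarith

/-- Backward greedy deletion from the full ground set. -/
theorem exists_objective_le {n d : ℕ} (a : Fin n → Fin d → ℝ) {lam : ℝ} (h : 0 < lam) (j : ℕ) :
    d + j ≤ n → ∃ S : Finset (Fin n), S.card = n - j ∧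
      objective a lam S * ((n : ℝ) - j - d + 1) ≤ ((n : ℝ) - d + 1) * objective a lam univ := by
  induction j with
  | zero =>
    intro _
    exact ⟨univ, by simp, by simp [mul_comm]⟩
  | succ j ih =>
    intro hj
    obtain ⟨S, hS, hle⟩ := ih (by omega)
    -- This deletion costs the factor (n−j−d+1)/(n−j−d), so the product telescopes.
    obtain ⟨i, hi, hi'⟩ := exists_erase_objective_le (m := n - j - 1) (by omega) a h
      (S := S) (by omega)
    refine ⟨S.erase i, by rw [card_erase_of_mem hi, hS]; omega, le_trans ?_ hle⟩
    have hcast : ((n - j - 1 : ℕ) : ℝ) = n - j - 1 := by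
      rw [Nat.cast_sub (by omega), Nat.cast_sub (by omega)]
      simp
    rw [hcast] at hi'
    push_cast
    linarith

end RAOD

/-! ### Assembling the three regimes -/

theorem corollary3 {n d k : ℕ} (hd : 1 ≤ d) (hdn : d ≤ n) (hk : 1 ≤ k) (hkn : k ≤ n)
    (a : Fin n → Fin d → ℝ) (lam : ℝ) (hlam : 0 < lam) :
    (k < d →
      1 ≤ RAOD.optVal a lam k / RAOD.relaxedVal a lam k ∧
      RAOD.optVal a lam k / RAOD.relaxedVal a lam k ≤
        min (((d : ℝ) - 1) / ((d : ℝ) - (k : ℝ))) ((n : ℝ) - (k : ℝ) + 1)) ∧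
    (k = d →
      1 ≤ RAOD.optVal a lam k / RAOD.relaxedVal a lam k ∧
      RAOD.optVal a lam k / RAOD.relaxedVal a lam k ≤
        min (d : ℝ) ((n : ℝ) - (d : ℝ) + 1)) ∧
    (d < k →
      1 ≤ RAOD.optVal a lam k / RAOD.relaxedVal a lam k ∧
      RAOD.optVal a lam k / RAOD.relaxedVal a lam k ≤
        ((n : ℝ) - (d : ℝ) + 1) / ((k : ℝ) - (d : ℝ) + 1)) := by
  have hk1 : (1 : ℝ) ≤ k := by exact_mod_cast hk
  have hkn' : (k : ℝ) ≤ n := by exact_mod_cast hkn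
  have hconv : ∀ x ∈ RAOD.relaxedDomain n k,
      0 ≤ RAOD.convGamma k lam (∑ i, x i • Matrix.vecMulVec (a i) (a i)) := fun x hx =>
    RAOD.convGamma_nonneg hlam (RAOD.posSemidef_sum_smul a fun i => (hx.1 i).1)
  refine ⟨fun hkd => ?_, fun hkd => ?_, fun hkd => ?_⟩
  · have hkd' : (k : ℝ) < d := by exact_mod_cast hkd
    have hδ : 0 ≤ ((d : ℝ) - k) / lam := div_nonneg (by linarith) hlam.le
    have hobj : ∀ x, RAOD.relaxedObjective a lam k x
        = RAOD.convGamma k lam (∑ i, x i • Matrix.vecMulVec (a i) (a i)) + ((d : ℝ) - k) / lam := by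
      intro x
      rw [RAOD.relaxedObjective, min_eq_left hkd.le]
    have h1 := RAOD.ratio_bounds (c := ((d : ℝ) - 1) / ((d : ℝ) - (k : ℝ))) hd hkn a hlam
      (div_pos (by linarith) (by linarith)) ?_
    · refine ⟨h1.1, le_min h1.2 (RAOD.ratio_bounds hd hkn a hlam (by linarith) ?_).2⟩
      intro x hx
      have h2 := (RAOD.optVal_sub_le_of_mem hk hdn hkd.le a hlam hx).2
      rw [hobj, mul_add]
      have h3 : ((d : ℝ) - k) / lam ≤ ((n : ℝ) - k + 1) * (((d : ℝ) - k) / lam) :=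
        le_mul_of_one_le_left hδ (by linarith)
      linarith
    · intro x hx
      have h2 := (RAOD.optVal_sub_le_of_mem hk hdn hkd.le a hlam hx).1
      have hN := hconv x hx
      rw [hobj, mul_add]
      set N := RAOD.convGamma k lam (∑ i, x i • Matrix.vecMulVec (a i) (a i))
      have h3 : ((d : ℝ) - 1) / ((d : ℝ) - k) * (((d : ℝ) - k) / lam) = ((d : ℝ) - 1) / lam := by
        have : (d : ℝ) - k ≠ 0 := (sub_pos.2 hkd').ne'
        field_simp
      have h4 : N ≤ ((d : ℝ) - 1) / ((d : ℝ) - k) * N :=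
        le_mul_of_one_le_left hN ((one_le_div (by linarith)).2 (by linarith))
      have h5 : RAOD.optVal a lam k ≤ d / lam := by
        obtain ⟨S, -, hS⟩ := RAOD.exists_optVal_eq hkn a lam
        rw [← hS]
        exact RAOD.objective_le a hlam S
      rw [h3]
      refine le_trans ?_ (add_le_add_left h4 _)
      have e1 : ((d : ℝ) - 1) / lam = d / lam - 1 / lam := sub_div _ _ _
      have e2 : ((d : ℝ) - k) / lam = d / lam - k * (1 / lam) := by ring
      rw [e2] at h2
      rw [e1]
      -- Adding k − 1 copies of z_k ≤ d/λ to the bound with c = k gives k z_k ≤ kN + k(d−1)/λ.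
      have h6 : (k : ℝ) * (RAOD.optVal a lam k - (N + (d / lam - 1 / lam))) ≤ 0 := by
        nlinarith [mul_le_mul_of_nonneg_left h5 (by linarith : (0 : ℝ) ≤ k - 1)]
      have := nonpos_of_mul_nonpos_right h6 (by linarith)
      linarith
  · subst hkd
    have hobj : ∀ x, RAOD.relaxedObjective a lam k x
        = RAOD.convGamma k lam (∑ i, x i • Matrix.vecMulVec (a i) (a i)) := by
      intro x
      rw [RAOD.relaxedObjective, min_self, sub_self, zero_div, add_zero]
    have h1 := RAOD.ratio_bounds (c := (k : ℝ)) hd hkn a hlam (by linarith) ?_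
    · refine ⟨h1.1, le_min h1.2 (RAOD.ratio_bounds hd hkn a hlam (by linarith) ?_).2⟩
      intro x hx
      have h2 := (RAOD.optVal_sub_le_of_mem hk hdn le_rfl a hlam hx).2
      rw [hobj]
      simpa using h2
    · intro x hx
      have h2 := (RAOD.optVal_sub_le_of_mem hk hdn le_rfl a hlam hx).1
      rw [hobj]
      simpa using h2
  · have hkd' : (d : ℝ) < k := by exact_mod_cast hkd
    refine RAOD.ratio_bounds hd hkn a hlam (div_pos (by linarith) (by linarith)) ?_
    intro x hx
    have hobj : RAOD.relaxedObjective a lam k x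
        = RAOD.convGamma k lam (∑ i, x i • Matrix.vecMulVec (a i) (a i)) := by
      rw [RAOD.relaxedObjective, min_eq_right hkd.le, sub_self, zero_div, add_zero]
    obtain ⟨S, hS, hle⟩ := RAOD.exists_objective_le a hlam (n - k) (by omega)
    have hz := RAOD.optVal_le a hlam (k := k) (hS.trans (by omega))
    have hc := RAOD.trace_inv_le_convGamma hkd.le a hlam (fun i => (hx.1 i).1) fun i => (hx.1 i).2
    rw [Nat.cast_sub hkn] at hle
    rw [hobj, div_mul_eq_mul_div, le_div_iff₀ (by linarith)]
    calc _ ≤ RAOD.objective a lam S * ((k : ℝ) - d + 1) :=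
          mul_le_mul_of_nonneg_right hz (by linarith)
      _ ≤ ((n : ℝ) - d + 1) * RAOD.objective a lam Finset.univ := by
          refine le_trans (le_of_eq ?_) hle
          ring
      _ ≤ _ := mul_le_mul_of_nonneg_left hc (by linarith)
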